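/- Let $P_1,P_2\subset\mathbb{R}^3$ be $3$-dimensional convex polytopes, let $P=P_1+P_2=\{x+y : x\in P_1,\ y\in P_2\}$ be their Minkowski sum, and let $f_k(Q)$ denote the number of $k$-dimensional faces of a polytope $Q$. Then $$f_2(P)\le f_0(P_1)f_0(P_2)+f_0(P_1)+f_0(P_2)-6,$$ $$f_1(P)\le 2f_0(P_1)f_0(P_2)+f_0(P_1)+f_0(P_2)-8.$$ Both bounds are tight: for all integers $n_1,n_2\ge 4$ there are $3$-dimensional polytopes $P_1,P_2\subset\mathbb{R}^3$ with $f_0(P_1)=n_1$ and $f_0(P_2)=n_2$ for which both inequalities hold with equality. -/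

import Mathlib

open scoped Pointwise

/-- A (convex) polytope: the convex hull of a finite set of points. -/
def IsPolytope {E : Type*} [AddCommGroup E] [Module ℝ E] (P : Set E) : Prop :=
  ∃ s : Set E, s.Finite ∧ P = convexHull ℝ s

/-- The dimension of a nonempty convex set: the dimension of the direction of its affine span. -/
noncomputable def convexDim {E : Type*} [AddCommGroup E] [Module ℝ E] (P : Set E) : ℕ :=
  Module.finrank ℝ (vectorSpan ℝ P)

/-- A `d`-polytope: a nonempty polytope of dimension `d`. -/
def IsDimPolytope {E : Type*} [AddCommGroup E] [Module ℝ E] (d : ℕ) (P : Set E) : Prop :=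
  IsPolytope P ∧ P.Nonempty ∧ convexDim P = d

/-- The set of `k`-faces of `P`. A nonempty face of `P` is the set of points of `P` at which some
linear functional attains its maximum over `P` (the zero functional gives `P` itself). -/
def kFaces {E : Type*} [NormedAddCommGroup E] [NormedSpace ℝ E] (k : ℕ) (P : Set E) :
    Set (Set E) :=
  {F | F.Nonempty ∧ IsExposed ℝ P F ∧ convexDim F = k}

/-- `f_k(P)`: the number of `k`-faces of `P`. -/
noncomputable def faceNumber {E : Type*} [NormedAddCommGroup E] [NormedSpace ℝ E] (k : ℕ)
    (P : Set E) : ℕ :=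
  (kFaces k P).ncard

/-- A polytope has finitely many `k`-faces, so `faceNumber` is a genuine count. -/
theorem IsPolytope.finite_kFaces {E : Type*} [NormedAddCommGroup E] [NormedSpace ℝ E]
    {P : Set E} (hP : IsPolytope P) (k : ℕ) : (kFaces k P).Finite := by
  obtain ⟨s, hs, rfl⟩ := hP
  refine (hs.finite_subsets.image (fun t => convexHull ℝ t)).subset ?_
  rintro F ⟨hne, hF, -⟩
  refine ⟨s ∩ F, Set.inter_subset_left, ?_⟩
  have hconv : Convex ℝ F := hF.convex (convex_convexHull ℝ s)
  refine Set.Subset.antisymm (convexHull_min Set.inter_subset_right hconv) ?_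
  have hK : IsCompact (convexHull ℝ s) := hs.isCompact_convexHull (𝕜 := ℝ)
  have hFc : IsCompact F := hF.isCompact hK
  have hsub : F.extremePoints ℝ ⊆ s ∩ F := fun x hx =>
    ⟨extremePoints_convexHull_subset (hF.isExtreme.extremePoints_subset_extremePoints hx), hx.1⟩
  refine (closure_convexHull_extremePoints hFc hconv).symm.subset.trans ?_
  exact (closure_mono (convexHull_mono hsub)).trans
    ((hs.inter_of_left F).isClosed_convexHull (𝕜 := ℝ)).closure_subset

/-! A polytope is replaced by its vertex set `S`, and its faces by the sets `argmaxOn S u`. Let n₁,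
n₂ be the vertex numbers of the summands and f₀, f₁, f₂ the face numbers of the sum; |F| is the
number of vertices of a facet F.

Upper bounds. The face of the sum exposed by u is the sum of the faces of the summands exposed by u.
If a facet of the sum comes from no facet of a summand, both of these faces are edges, they are not
parallel, and the facet is a parallelogram. So at most f₂(P₁) + f₂(P₂) ≤ (2n₁ - 4) + (2n₂ - 4)
facets are triangles, which gives 4f₂ + 8 ≤ Σ|F| + 2n₁ + 2n₂
(`IsVertexSum.four_mul_card_facets_le`). One half of Euler's formula says Σ|F| + 4 ≤ 2f₂ + 2f₀
(`sum_card_facets_add_four_le`); it comes from a sweep by a generic functional. With f₀ ≤ n₁n₂ this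
bounds f₂, and Σ|F| = 2f₁ (`two_mul_card_edges`) then bounds f₁.

Tightness. The vertices are put on two twisted cubics that are slight perturbations of parabolas in
perpendicular planes. Each summand is a cyclic polytope with at least 2nᵢ - 4 facets, and no
direction exposes a facet of both. Each of the nᵢ - 1 lower edges of one summand, joining
consecutive points, can be exposed together with each lower edge of the other, and so can the two
upper edges that join the first and last points (`exists_crossing`). Thus f₂ ≥ (2n₁ - 4) + (2n₂ - 4)
+ (n₁ - 1)(n₂ - 1) + 1 = n₁n₂ + n₁ + n₂ - 6. Equality for f₁ then follows from the triangle count,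
with no need for the other half of Euler's formula. -/

/-! ### Faces of finite point sets and their dimensions -/

section Combinatorial

open scoped Classical

variable {E : Type*} [AddCommGroup E] [Module ℝ E]

/-- The points of the finite set `S` at which the functional `u` is maximal on `S`. -/
noncomputable def argmaxOn (S : Finset E) (u : Module.Dual ℝ E) : Finset E :=
  {s ∈ S | ∀ t ∈ S, u t ≤ u s}

/-- The dimension of the affine span of a finite set. -/
noncomputable def vdim (A : Finset E) : ℕ := Module.finrank ℝ (vectorSpan ℝ (A : Set E))

/-- The vertex sets of the `k`-faces of the convex hull of `S`. -/
noncomputable def vertexFaces (k : ℕ) (S : Finset E) : Finset (Finset E) :=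
  {A ∈ S.powerset | (∃ u, A = argmaxOn S u) ∧ vdim A = k}

/-- Every point of `S` is the unique maximizer on `S` of some functional. -/
def ConvexPosition (S : Finset E) : Prop :=
  ∀ v ∈ S, ∃ u : Module.Dual ℝ E, ∀ s ∈ S, s ≠ v → u s < u v

theorem mem_argmaxOn {S : Finset E} {u : Module.Dual ℝ E} {s : E} :
    s ∈ argmaxOn S u ↔ s ∈ S ∧ ∀ t ∈ S, u t ≤ u s := by
  simp [argmaxOn]

theorem argmaxOn_subset (S : Finset E) (u : Module.Dual ℝ E) : argmaxOn S u ⊆ S :=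
  Finset.filter_subset _ _

theorem mem_vertexFaces {k : ℕ} {S A : Finset E} :
    A ∈ vertexFaces k S ↔ (∃ u, A = argmaxOn S u) ∧ vdim A = k := by
  simp only [vertexFaces, Finset.mem_filter, Finset.mem_powerset, and_iff_right_iff_imp]
  rintro ⟨⟨u, rfl⟩, -⟩
  exact argmaxOn_subset S u

theorem argmaxOn_nonempty {S : Finset E} (hS : S.Nonempty) (u : Module.Dual ℝ E) :
    (argmaxOn S u).Nonempty := by
  obtain ⟨s, hs, h⟩ := S.exists_max_image u hS
  exact ⟨s, mem_argmaxOn.2 ⟨hs, h⟩⟩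

theorem mem_argmaxOn_iff_of_le {S : Finset E} {u : Module.Dual ℝ E} {p s : E} (hp : p ∈ S)
    (h : ∀ t ∈ S, u t ≤ u p) : s ∈ argmaxOn S u ↔ s ∈ S ∧ u s = u p := by
  rw [mem_argmaxOn]
  constructor
  · rintro ⟨hs, h'⟩
    exact ⟨hs, le_antisymm (h s hs) (h' p hp)⟩
  · rintro ⟨hs, h'⟩
    exact ⟨hs, fun t ht => h' ▸ h t ht⟩

theorem mem_argmaxOn_iff {S : Finset E} {u : Module.Dual ℝ E} {p s : E}
    (hp : p ∈ argmaxOn S u) : s ∈ argmaxOn S u ↔ s ∈ S ∧ u s = u p :=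
  mem_argmaxOn_iff_of_le (mem_argmaxOn.1 hp).1 (mem_argmaxOn.1 hp).2

theorem argmaxOn_smul (S : Finset E) (u : Module.Dual ℝ E) {c : ℝ} (hc : 0 < c) :
    argmaxOn S (c • u) = argmaxOn S u := by
  ext s
  simp [mem_argmaxOn, mul_le_mul_iff_right₀ hc]

theorem argmaxOn_zero (S : Finset E) : argmaxOn S (0 : Module.Dual ℝ E) = S := by
  ext s
  simp [mem_argmaxOn]

/-- For large K the term `K • u` decides and `w` only breaks ties, so a face of a face is a face.
The `eventually` form lets one K serve several sets at once. -/
theorem eventually_argmaxOn_smul_add {S : Finset E} (hS : S.Nonempty) (u w : Module.Dual ℝ E) :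
    ∀ᶠ K : ℝ in Filter.atTop, argmaxOn S (K • u + w) = argmaxOn (argmaxOn S u) w := by
  obtain ⟨p, hp⟩ := argmaxOn_nonempty (argmaxOn_nonempty hS u) w
  have hp1 := mem_argmaxOn.1 hp
  have hp2 := mem_argmaxOn.1 hp1.1
  have key : ∀ᶠ K : ℝ in Filter.atTop, ∀ s ∈ S, u s < u p → w s - w p < K * (u p - u s) := by
    rw [Filter.eventually_all_finset]
    intro s _
    by_cases h : u s < u p
    · filter_upwards [Filter.eventually_gt_atTop ((w s - w p) / (u p - u s))] with K hK _
      exact (div_lt_iff₀ (sub_pos.2 h)).1 hK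
    · exact Filter.Eventually.of_forall fun K h' => absurd h' h
  filter_upwards [key] with K hK
  have hle : ∀ t ∈ S, (K • u + w) t ≤ (K • u + w) p := by
    intro t ht
    simp only [LinearMap.add_apply, LinearMap.smul_apply, smul_eq_mul]
    rcases (hp2.2 t ht).lt_or_eq with h | h
    · linarith [hK t ht h]
    · rw [h]
      have := hp1.2 t ((mem_argmaxOn_iff hp1.1).2 ⟨ht, h⟩)
      linarith
  ext s
  rw [mem_argmaxOn_iff_of_le hp2.1 hle, mem_argmaxOn_iff hp, mem_argmaxOn_iff hp1.1, and_assoc]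
  refine and_congr_right fun hs => ?_
  simp only [LinearMap.add_apply, LinearMap.smul_apply, smul_eq_mul]
  constructor
  · intro h
    rcases (hp2.2 s hs).lt_or_eq with h' | h'
    · linarith [hK s hs h']
    · rw [h'] at h
      exact ⟨h', by linarith⟩
  · rintro ⟨h1, h2⟩
    rw [h1, h2]

theorem exists_argmaxOn_eq_argmaxOn_argmaxOn {S : Finset E} (hS : S.Nonempty)
    (u w : Module.Dual ℝ E) : ∃ u', argmaxOn S u' = argmaxOn (argmaxOn S u) w :=
  let ⟨K, hK⟩ := (eventually_argmaxOn_smul_add hS u w).exists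
  ⟨K • u + w, hK⟩

theorem mem_dualAnnihilator_vectorSpan {A : Finset E} {u : Module.Dual ℝ E} {p : E} (hp : p ∈ A) :
    u ∈ (vectorSpan ℝ (A : Set E)).dualAnnihilator ↔ ∀ x ∈ A, u x = u p := by
  rw [vectorSpan_eq_span_vsub_set_right ℝ (Finset.mem_coe.2 hp), Submodule.mem_dualAnnihilator]
  constructor
  · intro h x hx
    have := h (x - p) (Submodule.subset_span ⟨x, hx, rfl⟩)
    rwa [map_sub, sub_eq_zero] at this
  · intro h
    change _ ≤ LinearMap.ker u
    rw [Submodule.span_le]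
    rintro _ ⟨x, hx, rfl⟩
    simp [h x hx]

theorem sub_mem_vectorSpan {A : Finset E} {x y : E} (hx : x ∈ A) (hy : y ∈ A) :
    x - y ∈ vectorSpan ℝ (A : Set E) :=
  vsub_mem_vectorSpan ℝ (Finset.mem_coe.2 hx) (Finset.mem_coe.2 hy)

theorem exists_ne_of_vdim_pos {A : Finset E} (h : 0 < vdim A) {x : E} :
    ∃ y ∈ A, y ≠ x := by
  by_contra! hc
  have : vectorSpan ℝ (A : Set E) = ⊥ := by
    refine vectorSpan_of_subsingleton ℝ fun a ha b hb => ?_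
    rw [hc a ha, hc b hb]
  rw [vdim, this] at h
  simp at h

/-- In a two-dimensional space, a nonzero vector extends to a basis. -/
theorem exists_pair_spanning {L : Type*} [AddCommGroup L] [Module ℝ L]
    (hL : Module.finrank ℝ L = 2) {x : L} (hx : x ≠ 0) :
    ∃ y : L, (∀ z, ∃ a b : ℝ, z = a • x + b • y) ∧ ∀ c : ℝ, y ≠ c • x := by
  have : FiniteDimensional ℝ L := FiniteDimensional.of_finrank_pos (by omega)
  have hlt : Submodule.span ℝ {x} < ⊤ := by
    refine lt_top_iff_ne_top.2 fun h => ?_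
    have := finrank_span_singleton (K := ℝ) hx
    rw [h, finrank_top] at this
    omega
  obtain ⟨y, -, hy⟩ := SetLike.exists_of_lt hlt
  have hyx : ∀ c : ℝ, y ≠ c • x := fun c hc => hy (hc ▸ Submodule.smul_mem _ _
    (Submodule.mem_span_singleton_self x))
  refine ⟨y, fun z => ?_, hyx⟩
  have hli : LinearIndependent ℝ ![x, y] :=
    (LinearIndependent.pair_iff' hx).2 fun a h => hyx a h.symm
  have hz : z ∈ Submodule.span ℝ (Set.range ![x, y]) := by
    rw [hli.span_eq_top_of_card_eq_finrank (by simp [hL])]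
    trivial
  rw [Matrix.range_cons, Matrix.range_cons, Matrix.range_empty, Set.union_empty,
    Set.singleton_union, Submodule.mem_span_pair] at hz
  obtain ⟨a, b, h⟩ := hz
  exact ⟨a, b, h.symm⟩

theorem exists_functional_pair {D : Submodule ℝ E} (hD : Module.finrank ℝ D = 2)
    {h : Module.Dual ℝ E} (hh : ∃ x ∈ D, h x ≠ 0) :
    ∃ w : Module.Dual ℝ E, (∀ u : Module.Dual ℝ E, ∃ a b : ℝ, ∀ x ∈ D, u x = a * h x + b * w x) ∧
      ∀ c : ℝ, ∃ x ∈ D, w x ≠ c * h x := by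
  have h0 : h.domRestrict D ≠ 0 := by
    obtain ⟨x, hx, hne⟩ := hh
    exact fun h' => hne (by simpa using LinearMap.congr_fun h' ⟨x, hx⟩)
  obtain ⟨y, hy, hy'⟩ := exists_pair_spanning (L := Module.Dual ℝ D)
    (by rw [Subspace.dual_finrank_eq, hD]) h0
  obtain ⟨w, rfl⟩ := LinearMap.exists_extend y
  refine ⟨w, fun u => ?_, fun c => ?_⟩
  · obtain ⟨a, b, hab⟩ := hy (u.domRestrict D)
    exact ⟨a, b, fun x hx => by simpa using LinearMap.congr_fun hab ⟨x, hx⟩⟩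
  · by_contra! hc
    exact hy' c (LinearMap.ext fun x => by simpa using hc x x.2)

theorem vdim_add_one_le_card {A : Finset E} (hA : A.Nonempty) : vdim A + 1 ≤ A.card := by
  have hc := hA.card_pos
  have := finrank_vectorSpan_image_finset_le ℝ (id : E → E) A (n := A.card - 1) (by omega)
  rw [Finset.coe_image, Set.image_id] at this
  unfold vdim
  omega

theorem ne_zero_of_vdim_argmaxOn {S : Finset E} {u : Module.Dual ℝ E}
    (h : vdim (argmaxOn S u) ≠ vdim S) : u ≠ 0 := by
  rintro rfl
  exact h (by rw [argmaxOn_zero])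

section FiniteDimensional

variable [FiniteDimensional ℝ E]

theorem vdim_mono {A B : Finset E} (h : A ⊆ B) : vdim A ≤ vdim B :=
  Submodule.finrank_mono (vectorSpan_mono ℝ (by exact_mod_cast h))

theorem vdim_lt_vdim {A B : Finset E} (h : A ⊆ B) {u : Module.Dual ℝ E} {p t : E} (hp : p ∈ A)
    (hA : ∀ x ∈ A, u x = u p) (ht : t ∈ B) (hB : u t ≠ u p) : vdim A < vdim B := by
  refine Submodule.finrank_lt_finrank_of_lt
    (lt_of_le_of_ne (vectorSpan_mono ℝ (by exact_mod_cast h)) fun heq => ?_)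
  have h1 := (mem_dualAnnihilator_vectorSpan hp).2 hA
  rw [heq, mem_dualAnnihilator_vectorSpan (h hp)] at h1
  exact hB (h1 t ht)

theorem vdim_pos {A : Finset E} {x y : E} (hx : x ∈ A) (hy : y ∈ A) (hne : x ≠ y) :
    0 < vdim A := by
  have : Nontrivial (vectorSpan ℝ (A : Set E)) :=
    Submodule.nontrivial_iff_ne_bot.2 fun h => hne <| by
      have := sub_mem_vectorSpan hx hy
      rw [h, Submodule.mem_bot] at this
      exact sub_eq_zero.1 this
  exact Module.finrank_pos

theorem two_le_finrank {D : Submodule ℝ E} {x y : E} (hx : x ∈ D) (hy : y ∈ D)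
    (hxy : ∀ a b : ℝ, a • x + b • y = 0 → a = 0 ∧ b = 0) : 2 ≤ Module.finrank ℝ D := by
  have hli : LinearIndependent ℝ ![(⟨x, hx⟩ : D), ⟨y, hy⟩] := by
    rw [LinearIndependent.pair_iff]
    intro a b h
    exact hxy a b (by simpa using congrArg Subtype.val h)
  simpa using hli.fintype_card_le_finrank

theorem finrank_dualAnnihilator_vectorSpan (A : Finset E) :
    vdim A + Module.finrank ℝ (vectorSpan ℝ (A : Set E)).dualAnnihilator = Module.finrank ℝ E :=
  Subspace.finrank_add_finrank_dualAnnihilator_eq _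

theorem vdim_lt_finrank {A : Finset E} {u : Module.Dual ℝ E} (hu : u ≠ 0) {p : E} (hp : p ∈ A)
    (h : ∀ x ∈ A, u x = u p) : vdim A < Module.finrank ℝ E := by
  rw [← finrank_dualAnnihilator_vectorSpan A]
  have : Nontrivial (vectorSpan ℝ (A : Set E)).dualAnnihilator :=
    ⟨⟨u, (mem_dualAnnihilator_vectorSpan hp).2 h⟩, 0, fun h => hu (congrArg Subtype.val h)⟩
  have := Module.finrank_pos (R := ℝ) (M := (vectorSpan ℝ (A : Set E)).dualAnnihilator)
  omega

end FiniteDimensional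

/-- The points (f t, w t) lie in an open half-plane, so the cone they span has two boundary rays, of
slopes m and M, and only the lines along these support it at the origin. Every later count of "two"
rests on this; since m = M is possible, two distinct supports need a further argument. -/
theorem exists_pencil_bounds {α : Type*} {T : Finset α} (hT : T.Nonempty) (f w : α → ℝ)
    (hf : ∀ t ∈ T, 0 < f t) :
    ∃ m M : ℝ, (∀ t ∈ T, m * f t ≤ w t) ∧ (∀ t ∈ T, w t ≤ M * f t) ∧
      (∃ t ∈ T, w t = m * f t) ∧ (∃ t ∈ T, w t = M * f t) ∧
      ∀ a b : ℝ, (a ≠ 0 ∨ b ≠ 0) → (∀ t ∈ T, a * f t + b * w t ≤ 0) →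
        (∃ t ∈ T, a * f t + b * w t = 0) → (0 < b ∧ a = -b * M) ∨ (b < 0 ∧ a = -b * m) := by
  obtain ⟨p, hp, hpmin⟩ := T.exists_min_image (fun t => w t / f t) hT
  obtain ⟨q, hq, hqmax⟩ := T.exists_max_image (fun t => w t / f t) hT
  have hm : ∀ t ∈ T, w p / f p * f t ≤ w t := fun t ht => (le_div_iff₀ (hf t ht)).1 (hpmin t ht)
  have hM : ∀ t ∈ T, w t ≤ w q / f q * f t := fun t ht => (div_le_iff₀ (hf t ht)).1 (hqmax t ht)
  have hp' : w p = w p / f p * f p := (div_mul_cancel₀ _ (hf p hp).ne').symm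
  have hq' : w q = w q / f q * f q := (div_mul_cancel₀ _ (hf q hq).ne').symm
  refine ⟨w p / f p, w q / f q, hm, hM, ⟨p, hp, hp'⟩, ⟨q, hq, hq'⟩, ?_⟩
  generalize w p / f p = m at *
  generalize w q / f q = M at *
  rintro a b hab hle ⟨t, ht, hz⟩
  have ht0 := hf t ht
  rcases lt_trichotomy b 0 with hb | rfl | hb
  · refine Or.inr ⟨hb, ?_⟩
    have h1 : (a + b * m) * f p ≤ 0 := by have := hle p hp; rw [hp'] at this; linarith
    have h2 : 0 ≤ (a + b * m) * f t := by nlinarith [hm t ht]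
    have := nonpos_of_mul_nonpos_left h1 (hf p hp)
    have := nonneg_of_mul_nonneg_left h2 ht0
    linarith
  · have : a = 0 := by simpa [ht0.ne'] using hz
    simp [this] at hab
  · refine Or.inl ⟨hb, ?_⟩
    have h1 : (a + b * M) * f q ≤ 0 := by have := hle q hq; rw [hq'] at this; linarith
    have h2 : 0 ≤ (a + b * M) * f t := by nlinarith [hM t ht]
    have := nonpos_of_mul_nonpos_left h1 (hf q hq)
    have := nonneg_of_mul_nonneg_left h2 ht0
    linarith

end Combinatorial

/-! ### Incidences of vertices, edges and facets -/

section Incidence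

open scoped Classical

variable {E : Type*} [AddCommGroup E] [Module ℝ E] [FiniteDimensional ℝ E]

/-- The functionals constant on `B` form a line, so facet normals are unique up to a factor. A
negative factor would make `u` both maximal and minimal on `B`, hence constant on `S`. -/
theorem exists_smul_eq_of_facets (hE : Module.finrank ℝ E = 3) {S : Finset E}
    (hS : vdim S = 3) {B : Finset E} {u u' : Module.Dual ℝ E} (hB : B ⊆ argmaxOn S u)
    (hB' : B ⊆ argmaxOn S u') (h2 : 2 ≤ vdim B) (hu : u ≠ 0) (hu' : u' ≠ 0) :
    ∃ c : ℝ, 0 < c ∧ u' = c • u := by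
  obtain ⟨p, hp, -⟩ := exists_ne_of_vdim_pos (show 0 < vdim B by omega) (x := (0 : E))
  have hpu := hB hp
  have hpu' := hB' hp
  have m1 : u ∈ (vectorSpan ℝ (B : Set E)).dualAnnihilator :=
    (mem_dualAnnihilator_vectorSpan hp).2 fun x hx => ((mem_argmaxOn_iff hpu).1 (hB hx)).2
  have m2 : u' ∈ (vectorSpan ℝ (B : Set E)).dualAnnihilator :=
    (mem_dualAnnihilator_vectorSpan hp).2 fun x hx => ((mem_argmaxOn_iff hpu').1 (hB' hx)).2
  have hfr : Module.finrank ℝ (vectorSpan ℝ (B : Set E)).dualAnnihilator = 1 := by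
    have := finrank_dualAnnihilator_vectorSpan B
    have := vdim_lt_finrank hu hp fun x hx => ((mem_argmaxOn_iff hpu).1 (hB hx)).2
    omega
  obtain ⟨c, hc⟩ := exists_smul_eq_of_finrank_eq_one hfr (x := ⟨u, m1⟩)
    (fun h => hu (congrArg Subtype.val h)) ⟨u', m2⟩
  have hcu : u' = c • u := (congrArg Subtype.val hc).symm
  refine ⟨c, ?_, hcu⟩
  by_contra hc'
  have hc0 : c < 0 := lt_of_le_of_ne (not_lt.1 hc') fun h => hu' (by rw [hcu, h, zero_smul])
  refine (vdim_lt_finrank hu (mem_argmaxOn.1 hpu).1 fun x hx => ?_).ne (hS.trans hE.symm)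
  have h1 := (mem_argmaxOn.1 hpu).2 x hx
  have h2 := (mem_argmaxOn.1 hpu').2 x hx
  rw [hcu] at h2
  simp only [LinearMap.smul_apply, smul_eq_mul] at h2
  exact le_antisymm h1 (le_of_not_gt fun h => by nlinarith)

/-- A facet containing a given edge, from a functional constant on the edge. -/
theorem argmaxOn_mem_facets (hE : Module.finrank ℝ E = 3) {S e : Finset E}
    (he : e ∈ vertexFaces 1 S)
    {u : Module.Dual ℝ E} (hu0 : u ≠ 0) {p : E} (hp : p ∈ e) (hconst : ∀ x ∈ e, u x = u p)
    (hle : ∀ s ∈ S, u s ≤ u p) (ht : ∃ t ∈ S \ e, u t = u p) :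
    argmaxOn S u ∈ vertexFaces 2 S ∧ e ⊆ argmaxOn S u := by
  obtain ⟨⟨u0, rfl⟩, hd⟩ := mem_vertexFaces.1 he
  have hpS := argmaxOn_subset _ _ hp
  have hsub : argmaxOn S u0 ⊆ argmaxOn S u := fun x hx =>
    (mem_argmaxOn_iff_of_le hpS hle).2 ⟨argmaxOn_subset _ _ hx, hconst x hx⟩
  refine ⟨mem_vertexFaces.2 ⟨⟨u, rfl⟩, ?_⟩, hsub⟩
  obtain ⟨t, ht, htp⟩ := ht
  rw [Finset.mem_sdiff] at ht
  have h1 : vdim (argmaxOn S u0) < vdim (argmaxOn S u) :=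
    vdim_lt_vdim hsub (u := u0) hp (fun x hx => ((mem_argmaxOn_iff hp).1 hx).2)
      ((mem_argmaxOn_iff_of_le hpS hle).2 ⟨ht.1, htp⟩)
      fun h => ht.2 ((mem_argmaxOn_iff hp).2 ⟨ht.1, h⟩)
  have h2 := vdim_lt_finrank hu0 (hsub hp) fun x hx => ((mem_argmaxOn_iff (hsub hp)).1 hx).2
  omega

/-- Every edge of a three-dimensional polytope lies in exactly two facets. -/
theorem card_facets_of_edge (hE : Module.finrank ℝ E = 3) {S : Finset E} (hS : vdim S = 3)
    {e : Finset E} (he : e ∈ vertexFaces 1 S) :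
    {F ∈ vertexFaces 2 S | e ⊆ F}.card = 2 := by
  obtain ⟨⟨u0, rfl⟩, hd⟩ := mem_vertexFaces.1 he
  set e := argmaxOn S u0 with he_def
  obtain ⟨p, hp, -⟩ := exists_ne_of_vdim_pos (show 0 < vdim e by omega) (x := (0 : E))
  have hpS := argmaxOn_subset _ _ hp
  have hu0 : u0 ≠ 0 := ne_zero_of_vdim_argmaxOn (by rw [hd, hS]; norm_num)
  have hle0 := (mem_argmaxOn.1 hp).2
  have hc0 : ∀ x ∈ e, u0 x = u0 p := fun x hx => ((mem_argmaxOn_iff hp).1 hx).2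
  -- The functionals constant on `e` form a plane with basis `u0`, `w`. Those of them that support
  -- `S` in more than `e` are the two extreme members of a pencil.
  have hann := finrank_dualAnnihilator_vectorSpan e
  obtain ⟨⟨w, hw⟩, hspan, hindep⟩ := exists_pair_spanning
    (L := (vectorSpan ℝ (e : Set E)).dualAnnihilator) (by omega)
    (x := ⟨u0, (mem_dualAnnihilator_vectorSpan hp).2 hc0⟩) (fun h => hu0 (congrArg Subtype.val h))
  have hwc := (mem_dualAnnihilator_vectorSpan hp).1 hw
  have hindep : ∀ c : ℝ, w - c • u0 ≠ 0 := fun c hc => hindep c (Subtype.ext (sub_eq_zero.1 hc))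
  have hspan : ∀ u : Module.Dual ℝ E, (∀ x ∈ e, u x = u p) → ∃ a b : ℝ, u = a • u0 + b • w := by
    intro u hu
    obtain ⟨a, b, hab⟩ := hspan ⟨u, (mem_dualAnnihilator_vectorSpan hp).2 hu⟩
    exact ⟨a, b, congrArg Subtype.val hab⟩
  have hf : ∀ t ∈ S \ e, 0 < u0 p - u0 t := fun t ht => by
    rw [Finset.mem_sdiff] at ht
    exact sub_pos.2 (lt_of_le_of_ne (hle0 t ht.1) fun h => ht.2 ((mem_argmaxOn_iff hp).2 ⟨ht.1, h⟩))
  have hT : (S \ e).Nonempty := by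
    rw [Finset.sdiff_nonempty]
    intro h
    have := vdim_mono h
    omega
  obtain ⟨m, M, hm, hM, ⟨tm, htm, hm'⟩, ⟨tM, htM, hM'⟩, huniq⟩ :=
    exists_pencil_bounds hT (fun t => u0 p - u0 t) (fun t => w t - w p) hf
  have hup : ∀ s ∈ S, (w + M • u0) s ≤ (w + M • u0) p := fun s hs => by
    simp only [LinearMap.add_apply, LinearMap.smul_apply, smul_eq_mul]
    by_cases hse : s ∈ e
    · rw [hwc s hse, hc0 s hse]
    · linarith [hM s (Finset.mem_sdiff.2 ⟨hs, hse⟩)]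
  have hum : ∀ s ∈ S, (-w - m • u0) s ≤ (-w - m • u0) p := fun s hs => by
    simp only [LinearMap.sub_apply, LinearMap.neg_apply, LinearMap.smul_apply, smul_eq_mul]
    by_cases hse : s ∈ e
    · rw [hwc s hse, hc0 s hse]
    · linarith [hm s (Finset.mem_sdiff.2 ⟨hs, hse⟩)]
  have hup0 : w + M • u0 ≠ 0 := fun h => hindep (-M) (by rw [← h]; module)
  have hum0 : -w - m • u0 ≠ 0 := fun h => hindep (-m) (by rw [← neg_eq_zero, ← h]; module)
  have hP := argmaxOn_mem_facets hE he hup0 hp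
    (fun x hx => by simp [hwc x hx, hc0 x hx]) hup ⟨tM, htM, by
      simp only [LinearMap.add_apply, LinearMap.smul_apply, smul_eq_mul]; linarith⟩
  have hQ := argmaxOn_mem_facets hE he hum0 hp
    (fun x hx => by simp [hwc x hx, hc0 x hx]) hum ⟨tm, htm, by
      simp only [LinearMap.sub_apply, LinearMap.neg_apply, LinearMap.smul_apply, smul_eq_mul]
      linarith⟩
  -- If the two facets coincided, then m = M, the two functionals would be opposite, and both would
  -- be constant on `S`.
  have hne : argmaxOn S (w + M • u0) ≠ argmaxOn S (-w - m • u0) := by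
    intro heq
    have h1 : tM ∈ argmaxOn S (w + M • u0) := (mem_argmaxOn_iff_of_le hpS hup).2
      ⟨(Finset.mem_sdiff.1 htM).1, by
        simp only [LinearMap.add_apply, LinearMap.smul_apply, smul_eq_mul]; linarith⟩
    rw [heq, mem_argmaxOn_iff_of_le hpS hum] at h1
    have h2 := h1.2
    simp only [LinearMap.sub_apply, LinearMap.neg_apply, LinearMap.smul_apply, smul_eq_mul] at h2
    have hmM : m = M := by
      have := hf tM htM
      have h3 : (M - m) * (u0 p - u0 tM) = 0 := by linarith
      rcases mul_eq_zero.1 h3 with h | h <;> linarith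
    refine (vdim_lt_finrank hup0 hpS fun s hs => le_antisymm (hup s hs) ?_).ne (hS.trans hE.symm)
    have := hum s hs
    rw [hmM] at this
    simp only [LinearMap.sub_apply, LinearMap.neg_apply, LinearMap.smul_apply, smul_eq_mul,
      LinearMap.add_apply] at this ⊢
    linarith
  rw [show {F ∈ vertexFaces 2 S | e ⊆ F} =
    {argmaxOn S (w + M • u0), argmaxOn S (-w - m • u0)} from ?_, Finset.card_pair hne]
  ext F
  simp only [Finset.mem_filter, Finset.mem_insert, Finset.mem_singleton]
  refine ⟨?_, by rintro (rfl | rfl) <;> assumption⟩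
  rintro ⟨hF, heF⟩
  obtain ⟨⟨u, rfl⟩, hFd⟩ := mem_vertexFaces.1 hF
  have hpu := heF hp
  obtain ⟨a, b, rfl⟩ := hspan u fun x hx => ((mem_argmaxOn_iff hpu).1 (heF hx)).2
  have hu := ne_zero_of_vdim_argmaxOn (S := S) (u := a • u0 + b • w) (by omega)
  have hmax := (mem_argmaxOn.1 hpu).2
  simp only [LinearMap.add_apply, LinearMap.smul_apply, smul_eq_mul] at hmax
  obtain ⟨t, ht, hte⟩ : ∃ t ∈ argmaxOn S (a • u0 + b • w), t ∉ e := by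
    by_contra! hc
    have := vdim_mono (show argmaxOn S (a • u0 + b • w) ⊆ e from hc)
    omega
  have ht' := (mem_argmaxOn_iff hpu).1 ht
  simp only [LinearMap.add_apply, LinearMap.smul_apply, smul_eq_mul] at ht'
  rcases huniq (-a) b (by
      by_contra! hc
      exact hu (by simp [neg_eq_zero.1 hc.1, hc.2]))
    (fun s hs => by linarith [hmax s (Finset.mem_sdiff.1 hs).1])
    ⟨t, Finset.mem_sdiff.2 ⟨ht'.1, hte⟩, by linarith [ht'.2]⟩ with ⟨hb, hab⟩ | ⟨hb, hab⟩
  · left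
    rw [show a • u0 + b • w = b • (w + M • u0) by
      rw [show a = b * M by linarith]; module, argmaxOn_smul _ _ hb]
  · right
    rw [show a • u0 + b • w = (-b) • (-w - m • u0) by
      rw [show a = b * m by linarith]; module, argmaxOn_smul _ _ (by linarith)]

theorem argmaxOn_mem_edges {S F : Finset E} (hF : F ∈ vertexFaces 2 S) {v : E} (hv : v ∈ F)
    {u : Module.Dual ℝ E} (hle : ∀ s ∈ F, u s ≤ u v) (h1 : ∃ t ∈ F, t ≠ v ∧ u t = u v)
    (h2 : ∃ s ∈ F, u s ≠ u v) :
    argmaxOn F u ∈ vertexFaces 1 S ∧ v ∈ argmaxOn F u ∧ argmaxOn F u ⊆ F := by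
  obtain ⟨⟨u0, rfl⟩, hd⟩ := mem_vertexFaces.1 hF
  have hvm : v ∈ argmaxOn (argmaxOn S u0) u := mem_argmaxOn.2 ⟨hv, hle⟩
  refine ⟨mem_vertexFaces.2 ⟨?_, ?_⟩, hvm, argmaxOn_subset _ _⟩
  · obtain ⟨u', h⟩ := exists_argmaxOn_eq_argmaxOn_argmaxOn ⟨v, argmaxOn_subset _ _ hv⟩ u0 u
    exact ⟨u', h.symm⟩
  · obtain ⟨t, ht, htv, htu⟩ := h1
    obtain ⟨s, hs, hsu⟩ := h2
    have l1 := vdim_pos ((mem_argmaxOn_iff hvm).2 ⟨ht, htu⟩) hvm htv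
    have l2 := vdim_lt_vdim (argmaxOn_subset (argmaxOn S u0) u) hvm
      (fun x hx => ((mem_argmaxOn_iff hvm).1 hx).2) hs hsu
    omega

/-- Every vertex of a facet lies in exactly two edges of that facet. -/
theorem card_edges_of_flag {S : Finset E} (hS : ConvexPosition S) {F : Finset E}
    (hF : F ∈ vertexFaces 2 S) {v : E} (hv : v ∈ F) :
    {e ∈ vertexFaces 1 S | v ∈ e ∧ e ⊆ F}.card = 2 := by
  obtain ⟨⟨u0, hFu⟩, hd⟩ := mem_vertexFaces.1 hF
  have hFS : F ⊆ S := hFu ▸ argmaxOn_subset _ _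
  -- Since `h` peaks on `F` only at `v`, the cone of `F` at `v` lies in an open half-plane; its two
  -- boundary rays carry the two edges.
  obtain ⟨h, hh⟩ := hS v (hFS hv)
  have hf : ∀ t ∈ F.erase v, 0 < h v - h t := fun t ht =>
    sub_pos.2 (hh t (hFS (Finset.mem_of_mem_erase ht)) (Finset.ne_of_mem_erase ht))
  obtain ⟨y, hyF, hyv⟩ := exists_ne_of_vdim_pos (show 0 < vdim F by omega) (x := v)
  have hT : (F.erase v).Nonempty := ⟨y, Finset.mem_erase.2 ⟨hyv, hyF⟩⟩
  obtain ⟨w, hspan, hindep⟩ := exists_functional_pair (D := vectorSpan ℝ (F : Set E)) hd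
    (h := h) ⟨y - v, sub_mem_vectorSpan hyF hv, by
      rw [map_sub]; exact (sub_neg.2 (hh y (hFS hyF) hyv)).ne⟩
  have hindep : ∀ c : ℝ, ∃ s ∈ F, (w - c • h) s ≠ (w - c • h) v := by
    intro c
    by_contra! hc
    obtain ⟨x, hx, hne⟩ := hindep c
    have := (Submodule.mem_dualAnnihilator _).1 ((mem_dualAnnihilator_vectorSpan hv).2 hc) x hx
    simp only [LinearMap.sub_apply, LinearMap.smul_apply, smul_eq_mul] at this
    exact hne (by linarith)
  have hspan : ∀ u : Module.Dual ℝ E, ∃ a b : ℝ, ∀ s ∈ F,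
      u s - u v = a * (h s - h v) + b * (w s - w v) := by
    intro u
    obtain ⟨a, b, hab⟩ := hspan u
    refine ⟨a, b, fun s hs => ?_⟩
    have := hab (s - v) (sub_mem_vectorSpan hs hv)
    simpa using this
  obtain ⟨m, M, hm, hM, ⟨tm, htm, hm'⟩, ⟨tM, htM, hM'⟩, huniq⟩ :=
    exists_pencil_bounds hT (fun t => h v - h t) (fun t => w t - w v) hf
  have hup : ∀ s ∈ F, (w + M • h) s ≤ (w + M • h) v := fun s hs => by
    simp only [LinearMap.add_apply, LinearMap.smul_apply, smul_eq_mul]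
    by_cases hse : s = v
    · rw [hse]
    · linarith [hM s (Finset.mem_erase.2 ⟨hse, hs⟩)]
  have hum : ∀ s ∈ F, (-w - m • h) s ≤ (-w - m • h) v := fun s hs => by
    simp only [LinearMap.sub_apply, LinearMap.neg_apply, LinearMap.smul_apply, smul_eq_mul]
    by_cases hse : s = v
    · rw [hse]
    · linarith [hm s (Finset.mem_erase.2 ⟨hse, hs⟩)]
  have htM2 : (w + M • h) tM = (w + M • h) v := by
    simp only [LinearMap.add_apply, LinearMap.smul_apply, smul_eq_mul]; linarith
  have htm2 : (-w - m • h) tm = (-w - m • h) v := by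
    simp only [LinearMap.sub_apply, LinearMap.neg_apply, LinearMap.smul_apply, smul_eq_mul]
    linarith
  have hP := argmaxOn_mem_edges hF hv hup
    ⟨tM, Finset.mem_of_mem_erase htM, Finset.ne_of_mem_erase htM, htM2⟩ (by
      obtain ⟨s, hs, hne⟩ := hindep (-M)
      refine ⟨s, hs, fun heq => hne ?_⟩
      simp only [LinearMap.sub_apply, LinearMap.add_apply, LinearMap.smul_apply,
        smul_eq_mul] at heq ⊢
      linarith)
  have hQ := argmaxOn_mem_edges hF hv hum
    ⟨tm, Finset.mem_of_mem_erase htm, Finset.ne_of_mem_erase htm, htm2⟩ (by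
      obtain ⟨s, hs, hne⟩ := hindep (-m)
      refine ⟨s, hs, fun heq => hne ?_⟩
      simp only [LinearMap.sub_apply, LinearMap.neg_apply, LinearMap.smul_apply,
        smul_eq_mul] at heq ⊢
      linarith)
  have hne : argmaxOn F (w + M • h) ≠ argmaxOn F (-w - m • h) := by
    intro heq
    have h1 : tM ∈ argmaxOn F (w + M • h) := (mem_argmaxOn_iff_of_le hv hup).2
      ⟨Finset.mem_of_mem_erase htM, htM2⟩
    rw [heq, mem_argmaxOn_iff_of_le hv hum] at h1
    have h2 := h1.2
    simp only [LinearMap.sub_apply, LinearMap.neg_apply, LinearMap.smul_apply, smul_eq_mul] at h2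
    have hmM : m = M := by
      have := hf tM htM
      have h3 : (M - m) * (h v - h tM) = 0 := by linarith
      rcases mul_eq_zero.1 h3 with h | h <;> linarith
    obtain ⟨s, hs, hne⟩ := hindep (-M)
    refine hne ?_
    have h3 := hum s hs
    have h4 := hup s hs
    rw [hmM] at h3
    simp only [LinearMap.sub_apply, LinearMap.neg_apply, LinearMap.smul_apply, smul_eq_mul,
      LinearMap.add_apply] at h3 h4 ⊢
    linarith
  rw [show {e ∈ vertexFaces 1 S | v ∈ e ∧ e ⊆ F} =
    {argmaxOn F (w + M • h), argmaxOn F (-w - m • h)} from ?_, Finset.card_pair hne]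
  ext e
  simp only [Finset.mem_filter, Finset.mem_insert, Finset.mem_singleton]
  refine ⟨?_, by rintro (rfl | rfl) <;> assumption⟩
  rintro ⟨he, hve, heF⟩
  obtain ⟨⟨u, rfl⟩, hed⟩ := mem_vertexFaces.1 he
  obtain ⟨a, b, hab⟩ := hspan u
  have hvmax := (mem_argmaxOn.1 hve).2
  have heq : argmaxOn S u = {s ∈ F | a * (h s - h v) + b * (w s - w v) = 0} := by
    ext s
    rw [Finset.mem_filter]
    constructor
    · intro hs
      rw [← hab s (heF hs), ((mem_argmaxOn_iff hve).1 hs).2]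
      exact ⟨heF hs, sub_self _⟩
    · rintro ⟨hs, h0⟩
      rw [← hab s hs, sub_eq_zero] at h0
      exact (mem_argmaxOn_iff hve).2 ⟨hFS hs, h0⟩
  obtain ⟨t, ht, htv⟩ := exists_ne_of_vdim_pos (show 0 < vdim (argmaxOn S u) by omega) (x := v)
  rcases huniq (-a) b (by
      by_contra! hc
      rw [Finset.filter_true_of_mem (by simp [neg_eq_zero.1 hc.1, hc.2])] at heq
      rw [heq] at hed
      omega)
    (fun s hs => by
      have := hab s (Finset.mem_of_mem_erase hs)
      linarith [hvmax s (hFS (Finset.mem_of_mem_erase hs))])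
    ⟨t, Finset.mem_erase.2 ⟨htv, heF ht⟩, by
      rw [heq, Finset.mem_filter] at ht
      linarith⟩ with ⟨hb, hab'⟩ | ⟨hb, hab'⟩
  · left
    ext s
    rw [heq, Finset.mem_filter, mem_argmaxOn_iff_of_le hv hup]
    refine and_congr_right fun _ => ?_
    rw [show a * (h s - h v) + b * (w s - w v) = b * ((w + M • h) s - (w + M • h) v) by
      rw [show a = b * M by linarith]
      simp only [LinearMap.add_apply, LinearMap.smul_apply, smul_eq_mul]; ring,
      mul_eq_zero, or_iff_right hb.ne', sub_eq_zero]
  · right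
    ext s
    rw [heq, Finset.mem_filter, mem_argmaxOn_iff_of_le hv hum]
    refine and_congr_right fun _ => ?_
    rw [show a * (h s - h v) + b * (w s - w v) = -b * ((-w - m • h) s - (-w - m • h) v) by
      rw [show a = b * m by linarith]
      simp only [LinearMap.sub_apply, LinearMap.neg_apply, LinearMap.smul_apply, smul_eq_mul]; ring,
      mul_eq_zero, or_iff_right (neg_ne_zero.2 hb.ne), sub_eq_zero]

end Incidence

/-! ### Euler's inequality by a sweep, and the count of edges -/

section Counting

open scoped Classical

variable {E : Type*} [AddCommGroup E] [Module ℝ E]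

/-- A functional that separates the points of a finite set. -/
theorem exists_injOn_dual (S : Finset E) :
    ∃ h : Module.Dual ℝ E, ∀ x ∈ S, ∀ y ∈ S, h x = h y → x = y := by
  obtain ⟨h, hh⟩ := Module.exists_dual_forall_apply_ne_zero (K := ℝ)
    (fun t : {t : S × S // t.1 ≠ t.2} => (t.1.1 : E) - (t.1.2 : E))
    (fun t h => t.2 (Subtype.ext (sub_eq_zero.1 h)))
  refine ⟨h, fun x hx y hy hxy => ?_⟩
  by_contra hne
  exact hh ⟨(⟨x, hx⟩, ⟨y, hy⟩), fun h => hne (congrArg Subtype.val h)⟩ (by simp [hxy])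

/-- Of three points on a line, the middle one is not the unique maximizer of any functional. -/
theorem card_eq_two_of_edge {S : Finset E} (hS : ConvexPosition S) {e : Finset E}
    (he : e ∈ vertexFaces 1 S) : e.card = 2 := by
  obtain ⟨⟨u0, hu0⟩, hd⟩ := mem_vertexFaces.1 he
  obtain ⟨a, ha, -⟩ := exists_ne_of_vdim_pos (show 0 < vdim e by omega) (x := (0 : E))
  obtain ⟨b, hb, hba⟩ := exists_ne_of_vdim_pos (show 0 < vdim e by omega) (x := a)
  have hlow := vdim_add_one_le_card ⟨a, ha⟩
  have hr : ∀ x : e, ∃ r : ℝ, (x : E) = a + r • (b - a) := fun x => by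
    obtain ⟨r, hr⟩ := exists_smul_eq_of_finrank_eq_one hd
      (x := ⟨b - a, sub_mem_vectorSpan hb ha⟩)
      (fun h => hba (sub_eq_zero.1 (congrArg Subtype.val h))) ⟨x - a, sub_mem_vectorSpan x.2 ha⟩
    have : r • (b - a) = (x : E) - a := congrArg Subtype.val hr
    exact ⟨r, by rw [this]; abel⟩
  choose r hr using hr
  obtain ⟨lo, -, hlo⟩ := Finset.univ.exists_min_image r ⟨⟨a, ha⟩, Finset.mem_univ _⟩
  obtain ⟨hi, -, hhi⟩ := Finset.univ.exists_max_image r ⟨⟨a, ha⟩, Finset.mem_univ _⟩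
  refine le_antisymm ?_ (by omega)
  by_contra! hc
  obtain ⟨z, hz, hzn⟩ : ∃ z ∈ e, z ∉ ({(lo : E), (hi : E)} : Finset E) := by
    by_contra! h
    have := Finset.card_le_card (show e ⊆ {(lo : E), (hi : E)} from h)
    have := Finset.card_le_two (a := (lo : E)) (b := hi)
    omega
  simp only [Finset.mem_insert, Finset.mem_singleton, not_or] at hzn
  have heS : e ⊆ S := hu0 ▸ argmaxOn_subset _ _
  obtain ⟨u, hu⟩ := hS z (heS hz)
  have h1 := hu lo (heS lo.2) (Ne.symm hzn.1)
  have h2 := hu hi (heS hi.2) (Ne.symm hzn.2)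
  have hz1 := hlo ⟨z, hz⟩ (Finset.mem_univ _)
  have hz2 := hhi ⟨z, hz⟩ (Finset.mem_univ _)
  have hval : ∀ x : e, u x = u a + r x * u (b - a) := fun x => by
    conv_lhs => rw [hr x]
    simp
  rw [hval lo, hval ⟨z, hz⟩] at h1
  rw [hval hi, hval ⟨z, hz⟩] at h2
  rcases le_total 0 (u (b - a)) with h | h
  · linarith [mul_le_mul_of_nonneg_right hz2 h]
  · linarith [mul_le_mul_of_nonpos_right hz1 h]

variable [FiniteDimensional ℝ E]

/-- At most two facets through a vertex `v` have vertices strictly above and strictly below `v`. -/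
theorem card_crossing_facets_le (hE : Module.finrank ℝ E = 3) {S : Finset E}
    (hS : ConvexPosition S) (hd : vdim S = 3) (h : Module.Dual ℝ E) {v : E} (hv : v ∈ S) :
    {F ∈ vertexFaces 2 S | v ∈ F ∧ (∃ s ∈ F, h v < h s) ∧ ∃ s ∈ F, h s < h v}.card ≤ 2 := by
  rcases Finset.eq_empty_or_nonempty
    {F ∈ vertexFaces 2 S | v ∈ F ∧ (∃ s ∈ F, h v < h s) ∧ ∃ s ∈ F, h s < h v} with h0 | ⟨F₀, hF₀⟩
  · simp [h0]
  obtain ⟨g, hg⟩ := hS v hv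
  have sub : ∀ F ∈ vertexFaces 2 S, F ⊆ S := fun F hF => by
    obtain ⟨⟨u, rfl⟩, -⟩ := mem_vertexFaces.1 hF
    exact argmaxOn_subset _ _
  set T : Finset (E × E) := {t ∈ S ×ˢ S | h v < h t.1 ∧ h t.2 < h v} with hTdef
  have memT : ∀ t : E × E, t ∈ T ↔ (t.1 ∈ S ∧ t.2 ∈ S) ∧ h v < h t.1 ∧ h t.2 < h v := by
    simp [hTdef]
  -- `τ t` is the positive combination of the directions from `v` to a higher and to a lower point
  -- that stays in the level plane of `h`. Crossing facets meet that plane in edges at `v` of a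
  -- planar section, and there are at most two of these.
  set τ : E × E → E := fun t => (h v - h t.2) • (t.1 - v) + (h t.1 - h v) • (t.2 - v) with hτ
  have uτ : ∀ (u : Module.Dual ℝ E) t,
      u (τ t) = (h v - h t.2) * (u t.1 - u v) + (h t.1 - h v) * (u t.2 - u v) := fun u t => by
    simp [hτ]
  have hτker : ∀ t, τ t ∈ LinearMap.ker h := fun t => by rw [LinearMap.mem_ker, uτ]; ring
  have hgτ : ∀ t ∈ T, 0 < -g (τ t) := fun t ht => by
    rw [memT] at ht
    obtain ⟨⟨h1, h2⟩, h3, h4⟩ := ht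
    rw [uτ]
    have e1 := hg _ h1 fun h => h3.ne (by rw [h])
    have e2 := hg _ h2 fun h => h4.ne (by rw [h])
    nlinarith [mul_pos (sub_pos.2 h4) (sub_pos.2 e1), mul_pos (sub_pos.2 h3) (sub_pos.2 e2)]
  obtain ⟨hF0, hvF0, ⟨s, hs, hs'⟩, s', hs2, hs2'⟩ := Finset.mem_filter.1 hF₀
  have hT : T.Nonempty := ⟨(s, s'), (memT _).2 ⟨⟨sub _ hF0 hs, sub _ hF0 hs2⟩, hs', hs2'⟩⟩
  have hh0 : h ≠ 0 := by
    rintro rfl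
    simp at hs'
  have hker : Module.finrank ℝ (LinearMap.ker h) = 2 := by
    have := Module.Dual.finrank_ker_add_one_of_ne_zero hh0
    omega
  obtain ⟨w, hspan, -⟩ := exists_functional_pair hker (h := g) (by
    obtain ⟨t, ht⟩ := hT
    exact ⟨τ t, hτker t, by linarith [hgτ t ht]⟩)
  obtain ⟨m, M, -, -, -, -, huniq⟩ :=
    exists_pencil_bounds hT (fun t => -g (τ t)) (fun t => w (τ t)) hgτ
  have main : ∀ F ∈ vertexFaces 2 S, v ∈ F → (∃ s ∈ F, h v < h s) → (∃ s ∈ F, h s < h v) →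
      {t ∈ T | t.1 ∈ F ∧ t.2 ∈ F} ∈ ({{t ∈ T | w (τ t) = M * -g (τ t)},
        {t ∈ T | w (τ t) = m * -g (τ t)}} : Finset (Finset (E × E))) := by
    intro F hF hvF ⟨s, hs, hsv⟩ ⟨s', hs', hsv'⟩
    obtain ⟨⟨u, rfl⟩, hFd⟩ := mem_vertexFaces.1 hF
    obtain ⟨a, b, hab⟩ := hspan u
    have hmax := (mem_argmaxOn.1 hvF).2
    have hz : ∀ t ∈ T, (t.1 ∈ argmaxOn S u ∧ t.2 ∈ argmaxOn S u ↔ u (τ t) = 0) ∧ u (τ t) ≤ 0 := by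
      intro t ht
      obtain ⟨⟨h1, h2⟩, h3, h4⟩ := (memT t).1 ht
      have e1 : (h v - h t.2) * (u t.1 - u v) ≤ 0 :=
        mul_nonpos_of_nonneg_of_nonpos (by linarith) (by linarith [hmax _ h1])
      have e2 : (h t.1 - h v) * (u t.2 - u v) ≤ 0 :=
        mul_nonpos_of_nonneg_of_nonpos (by linarith) (by linarith [hmax _ h2])
      rw [mem_argmaxOn_iff hvF, mem_argmaxOn_iff hvF, uτ]
      refine ⟨⟨?_, fun h0 => ⟨⟨h1, ?_⟩, h2, ?_⟩⟩, by linarith⟩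
      · rintro ⟨⟨-, h5⟩, -, h6⟩
        rw [h5, h6]
        ring
      · have : (h v - h t.2) * (u t.1 - u v) = 0 := by linarith
        rcases mul_eq_zero.1 this with h | h <;> linarith
      · have : (h t.1 - h v) * (u t.2 - u v) = 0 := by linarith
        rcases mul_eq_zero.1 this with h | h <;> linarith
    have hsT : (s, s') ∈ T := (memT _).2 ⟨⟨sub _ hF hs, sub _ hF hs'⟩, hsv, hsv'⟩
    have hab' : ∀ t, u (τ t) = -a * -g (τ t) + b * w (τ t) := fun t => by
      rw [hab _ (hτker t)]
      ring
    -- Otherwise `u` vanishes on `ker h`; as `u` agrees at `s` and `v` while `h` does not, `u` would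
    -- be zero.
    have hne : -a ≠ 0 ∨ b ≠ 0 := by
      by_contra! hc
      have hu0 : ∀ x ∈ LinearMap.ker h, u x = 0 := fun x hx => by
        rw [hab x hx, neg_eq_zero.1 hc.1, hc.2]
        ring
      have hker_all : ∀ x, h (s - v) * u x = 0 := fun x => by
        have := hu0 (h (s - v) • x - h x • (s - v)) (by
          rw [LinearMap.mem_ker]
          simp only [map_sub, map_smul, smul_eq_mul]
          ring)
        have hus := ((mem_argmaxOn_iff hvF).1 hs).2
        simp only [map_sub, map_smul, smul_eq_mul, hus] at this ⊢
        linarith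
      have : u = 0 := LinearMap.ext fun x =>
        (mul_eq_zero.1 (hker_all x)).resolve_left (by rw [map_sub]; linarith)
      rw [this, argmaxOn_zero] at hFd
      omega
    have hfil : {t ∈ T | t.1 ∈ argmaxOn S u ∧ t.2 ∈ argmaxOn S u} =
        {t ∈ T | -a * -g (τ t) + b * w (τ t) = 0} :=
      Finset.filter_congr fun t ht => by rw [(hz t ht).1, hab']
    rw [hfil, Finset.mem_insert, Finset.mem_singleton]
    rcases huniq (-a) b hne (fun t ht => by rw [← hab']; exact (hz t ht).2)
      ⟨_, hsT, by rw [← hab', ← (hz _ hsT).1]; exact ⟨hs, hs'⟩⟩ with ⟨hb, hab2⟩ | ⟨hb, hab2⟩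
    · left
      refine Finset.filter_congr fun t _ => ?_
      rw [hab2, show -b * M * -g (τ t) + b * w (τ t) = b * (w (τ t) - M * -g (τ t)) by ring,
        mul_eq_zero, or_iff_right hb.ne', sub_eq_zero]
    · right
      refine Finset.filter_congr fun t _ => ?_
      rw [hab2, show -b * m * -g (τ t) + b * w (τ t) = b * (w (τ t) - m * -g (τ t)) by ring,
        mul_eq_zero, or_iff_right hb.ne, sub_eq_zero]
  refine (Finset.card_le_card_of_injOn (fun F => {t ∈ T | t.1 ∈ F ∧ t.2 ∈ F})
    (fun F hF => ?_) ?_).trans (Finset.card_le_two (a := {t ∈ T | w (τ t) = M * -g (τ t)})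
      (b := {t ∈ T | w (τ t) = m * -g (τ t)}))
  · obtain ⟨h1, h2, h3, h4⟩ := Finset.mem_filter.1 (Finset.mem_coe.1 hF)
    exact Finset.mem_coe.2 (main F h1 h2 h3 h4)
  · intro F hF F' hF' heq
    obtain ⟨h1, h2, ⟨s, hs, hsv⟩, s', hs', hsv'⟩ := Finset.mem_filter.1 (Finset.mem_coe.1 hF)
    obtain ⟨h1', h2', -⟩ := Finset.mem_filter.1 (Finset.mem_coe.1 hF')
    have hm : (s, s') ∈ {t ∈ T | t.1 ∈ F ∧ t.2 ∈ F} := Finset.mem_filter.2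
      ⟨(memT _).2 ⟨⟨sub _ h1 hs, sub _ h1 hs'⟩, hsv, hsv'⟩, hs, hs'⟩
    dsimp only at heq
    rw [heq, Finset.mem_filter] at hm
    obtain ⟨-, hm1, hm2⟩ := hm
    dsimp only at hm1 hm2
    obtain ⟨⟨u, rfl⟩, hd1⟩ := mem_vertexFaces.1 h1
    obtain ⟨⟨u', rfl⟩, hd2⟩ := mem_vertexFaces.1 h1'
    -- A crossing facet is determined by one of its pairs: `v`, `s`, `s'` are not collinear, because
    -- `g` drops from `v` to both while `h` rises to one and falls to the other.
    have hB : 2 ≤ vdim ({v, s, s'} : Finset E) := by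
      refine two_le_finrank (x := s - v) (y := s' - v) (sub_mem_vectorSpan (by simp) (by simp))
        (sub_mem_vectorSpan (by simp) (by simp)) fun a b hab => ?_
      have e1 := congrArg h hab
      have e2 := congrArg g hab
      have g1 := hg s (sub _ h1 hs) fun h => hsv.ne (by rw [h])
      have g2 := hg s' (sub _ h1 hs') fun h => hsv'.ne (by rw [h])
      simp only [map_add, map_smul, map_sub, smul_eq_mul, map_zero] at e1 e2
      have hdet : (h s - h v) * (g s' - g v) - (h s' - h v) * (g s - g v) < 0 := by nlinarith
      constructor
      · refine (mul_eq_zero.1 (?_ : a * ((h s - h v) * (g s' - g v) - (h s' - h v) * (g s - g v))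
          = 0)).resolve_right hdet.ne
        linear_combination (g s' - g v) * e1 - (h s' - h v) * e2
      · refine (mul_eq_zero.1 (?_ : b * ((h s - h v) * (g s' - g v) - (h s' - h v) * (g s - g v))
          = 0)).resolve_right hdet.ne
        linear_combination (h s - h v) * e2 - (g s - g v) * e1
    obtain ⟨c, hc, rfl⟩ := exists_smul_eq_of_facets hE hd (B := {v, s, s'}) (u := u) (u' := u')
      (by simp [Finset.insert_subset_iff, h2, hs, hs'])
      (by simp [Finset.insert_subset_iff, h2', hm1, hm2]) hB
      (ne_zero_of_vdim_argmaxOn (S := S) (by omega)) (ne_zero_of_vdim_argmaxOn (S := S) (by omega))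
    exact (argmaxOn_smul S u hc).symm

/-- All but the top and bottom vertex of a facet are crossed by it in the sense of `cross`. A vertex
of `S` is crossed by at most two facets, and the top and bottom of `S` by none. Counting crossings
both ways gives Σ(|F| - 2) ≤ 2(|S| - 2). -/
theorem sum_card_facets_add_four_le (hE : Module.finrank ℝ E = 3) {S : Finset E}
    (hS : ConvexPosition S) (hd : vdim S = 3) :
    ∑ F ∈ vertexFaces 2 S, F.card + 4 ≤ 2 * (vertexFaces 2 S).card + 2 * S.card := by
  obtain ⟨h, hinj⟩ := exists_injOn_dual S
  have sub : ∀ F ∈ vertexFaces 2 S, F ⊆ S := fun F hF => by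
    obtain ⟨⟨u, rfl⟩, -⟩ := mem_vertexFaces.1 hF
    exact argmaxOn_subset _ _
  let cross : E → Finset E → Prop := fun v F =>
    v ∈ F ∧ (∃ s ∈ F, h v < h s) ∧ ∃ s ∈ F, h s < h v
  have h1 : ∀ F ∈ vertexFaces 2 S, F.card ≤ {v ∈ S | cross v F}.card + 2 := by
    intro F hF
    have hone : ∀ g : Module.Dual ℝ E, (∀ x y, g x = g y → h x = h y) →
        (argmaxOn F g).card ≤ 1 := fun g hg => by
      refine Finset.card_le_one.2 fun x hx y hy => ?_
      have := ((mem_argmaxOn_iff hx).1 hy).2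
      exact hinj _ (sub F hF (argmaxOn_subset _ _ hx)) _ (sub F hF (argmaxOn_subset _ _ hy))
        (hg _ _ this.symm)
    have hsub : F ⊆ {v ∈ S | cross v F} ∪ (argmaxOn F h ∪ argmaxOn F (-h)) := by
      intro v hv
      simp only [Finset.mem_union, Finset.mem_filter, mem_argmaxOn, LinearMap.neg_apply,
        neg_le_neg_iff]
      by_contra! hc
      obtain ⟨c1, c2, c3⟩ := hc
      exact c1 (sub F hF hv) ⟨hv, c2 hv, c3 hv⟩
    have := Finset.card_le_card hsub
    have := Finset.card_union_le {v ∈ S | cross v F} (argmaxOn F h ∪ argmaxOn F (-h))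
    have := Finset.card_union_le (argmaxOn F h) (argmaxOn F (-h))
    have := hone h fun _ _ h => h
    have := hone (-h) fun _ _ h => by simpa using h
    omega
  obtain ⟨p, hp, -⟩ := exists_ne_of_vdim_pos (show 0 < vdim S by omega) (x := (0 : E))
  obtain ⟨a, ha⟩ := argmaxOn_nonempty ⟨p, hp⟩ h
  obtain ⟨b, hb⟩ := argmaxOn_nonempty ⟨p, hp⟩ (-h)
  rw [mem_argmaxOn] at ha hb
  simp only [LinearMap.neg_apply, neg_le_neg_iff] at hb
  have hab : a ≠ b := by
    rintro rfl
    obtain ⟨q, hq, hqa⟩ := exists_ne_of_vdim_pos (show 0 < vdim S by omega) (x := a)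
    exact hqa (hinj q hq a ha.1 (le_antisymm (ha.2 q hq) (hb.2 q hq)))
  have h2 : ∑ v ∈ S, {F ∈ vertexFaces 2 S | cross v F}.card ≤ ∑ v ∈ S \ {a, b}, 2 := by
    rw [← Finset.sum_subset (s₁ := S \ {a, b}) (s₂ := S) Finset.sdiff_subset]
    · exact Finset.sum_le_sum fun v hv =>
        card_crossing_facets_le hE hS hd h (Finset.mem_sdiff.1 hv).1
    · intro v hv hv'
      rw [Finset.card_eq_zero, Finset.filter_eq_empty_iff]
      rintro F hF ⟨-, ⟨s, hs, hs'⟩, t, ht, ht'⟩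
      have hv2 : v = a ∨ v = b := by
        by_contra hc
        exact hv' (Finset.mem_sdiff.2 ⟨hv, by simpa using hc⟩)
      rcases hv2 with rfl | rfl
      · exact absurd (ha.2 s (sub F hF hs)) (not_le.2 hs')
      · exact absurd (hb.2 t (sub F hF ht)) (not_le.2 ht')
  have h3 : ∑ v ∈ S, {F ∈ vertexFaces 2 S | cross v F}.card =
      ∑ F ∈ vertexFaces 2 S, {v ∈ S | cross v F}.card :=
    Finset.sum_card_bipartiteAbove_eq_sum_card_bipartiteBelow cross
  have h4 := Finset.sum_le_sum h1
  rw [Finset.sum_add_distrib] at h4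
  have h5 : (S \ {a, b}).card + 2 = S.card := by
    rw [← Finset.card_pair hab]
    exact Finset.card_sdiff_add_card_eq_card (by simp [Finset.insert_subset_iff, ha.1, hb.1])
  simp only [Finset.sum_const, smul_eq_mul] at h2 h4
  omega

/-- Counting vertex-edge flags inside a facet shows that it has as many edges as vertices; each edge
lies in two facets. -/
theorem two_mul_card_edges (hE : Module.finrank ℝ E = 3) {S : Finset E}
    (hS : ConvexPosition S) (hd : vdim S = 3) :
    2 * (vertexFaces 1 S).card = ∑ F ∈ vertexFaces 2 S, F.card := by
  have hpoly : ∀ F ∈ vertexFaces 2 S, {e ∈ vertexFaces 1 S | e ⊆ F}.card = F.card := by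
    intro F hF
    have h := Finset.sum_card_bipartiteAbove_eq_sum_card_bipartiteBelow
      (s := F) (t := {e ∈ vertexFaces 1 S | e ⊆ F}) (fun v e => v ∈ e)
    rw [Finset.sum_congr rfl (g := fun _ => 2) fun v hv => ?_,
      Finset.sum_congr (s₁ := {e ∈ vertexFaces 1 S | e ⊆ F}) rfl (g := fun _ => 2)
        fun e he => ?_] at h
    · simp only [Finset.sum_const, smul_eq_mul] at h
      omega
    · rw [Finset.mem_filter] at he
      rw [Finset.bipartiteBelow, ← card_eq_two_of_edge hS he.1]
      congr 1
      ext v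
      simp only [Finset.mem_filter, and_iff_right_iff_imp]
      exact fun hv => he.2 hv
    · rw [Finset.bipartiteAbove, Finset.filter_filter, ← card_edges_of_flag hS hF hv]
      congr 1
      ext e
      simp only [Finset.mem_filter]
      tauto
  rw [← Finset.sum_congr rfl hpoly]
  have := Finset.sum_card_bipartiteAbove_eq_sum_card_bipartiteBelow
      (s := vertexFaces 1 S) (t := vertexFaces 2 S) (fun e F => e ⊆ F)
  rw [Finset.sum_congr rfl (g := fun _ => 2)
    fun e he => by exact card_facets_of_edge hE hd he] at this
  simp only [Finset.sum_const, smul_eq_mul] at this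
  rw [mul_comm, this]
  rfl

end Counting

/-! ### Passing between point sets and convex hulls -/

section Hull

open scoped Classical

variable {E : Type*} [AddCommGroup E] [Module ℝ E]

/-- At a maximum of `u` on the hull, a convex combination can give no weight to points where `u` is
smaller. -/
theorem mem_convexHull_argmaxOn {S : Finset E} {u : Module.Dual ℝ E} {x : E} :
    x ∈ convexHull ℝ (argmaxOn S u : Set E) ↔
      x ∈ convexHull ℝ (S : Set E) ∧ ∀ t ∈ S, u t ≤ u x := by
  constructor
  · intro hx
    refine ⟨convexHull_mono (by exact_mod_cast argmaxOn_subset S u) hx, fun t ht => ?_⟩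
    have hconv : Convex ℝ {y | u t ≤ u y} := convex_halfSpace_ge u.isLinear _
    exact convexHull_min (fun y hy => (mem_argmaxOn.1 (Finset.mem_coe.1 hy)).2 t ht) hconv hx
  · rintro ⟨hx, hmax⟩
    obtain ⟨w, hw0, hw1, hwx⟩ := Finset.mem_convexHull'.1 hx
    have hsum : ∑ y ∈ S, w y * (u x - u y) = 0 := by
      have : u x = ∑ y ∈ S, w y * u y := by
        conv_lhs => rw [← hwx]
        simp
      simp only [mul_sub, Finset.sum_sub_distrib, ← Finset.sum_mul]
      rw [hw1, ← this]
      ring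
    have hzero : ∀ y ∈ S, y ∉ argmaxOn S u → w y = 0 := by
      intro y hy hyn
      have h := (Finset.sum_eq_zero_iff_of_nonneg fun y hy =>
        mul_nonneg (hw0 y hy) (sub_nonneg.2 (hmax y hy))).1 hsum y hy
      rcases mul_eq_zero.1 h with h | h
      · exact h
      · exact absurd (mem_argmaxOn.2 ⟨hy, fun t ht => by linarith [hmax t ht]⟩) hyn
    refine Finset.mem_convexHull'.2 ⟨w, fun y hy => hw0 y (argmaxOn_subset _ _ hy), ?_, ?_⟩
    · rw [← hw1]
      exact Finset.sum_subset (argmaxOn_subset S u) hzero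
    · rw [← hwx]
      exact Finset.sum_subset (argmaxOn_subset S u) fun y hy hyn => by
        rw [hzero y hy hyn, zero_smul]

theorem le_of_mem_convexHull {S : Finset E} {u : Module.Dual ℝ E} {c : ℝ}
    (h : ∀ s ∈ S, u s ≤ c) {y : E} (hy : y ∈ convexHull ℝ (S : Set E)) : u y ≤ c :=
  convexHull_min (fun s hs => h s (Finset.mem_coe.1 hs)) (convex_halfSpace_le u.isLinear c) hy

theorem argmaxOn_eq_filter_convexHull (S : Finset E) (u : Module.Dual ℝ E) :
    argmaxOn S u = {s ∈ S | s ∈ convexHull ℝ (argmaxOn S u : Set E)} := by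
  ext s
  rw [Finset.mem_filter, mem_convexHull_argmaxOn, mem_argmaxOn]
  exact ⟨fun h => ⟨h.1, subset_convexHull ℝ _ h.1, h.2⟩, fun h => ⟨h.1, h.2.2⟩⟩

theorem vectorSpan_convexHull (s : Set E) :
    vectorSpan ℝ (convexHull ℝ s) = vectorSpan ℝ s := by
  rw [← direction_affineSpan, affineSpan_convexHull, direction_affineSpan]

theorem card_vertexFaces_zero [FiniteDimensional ℝ E] {S : Finset E} (hne : S.Nonempty)
    (hS : ConvexPosition S) : (vertexFaces 0 S).card = S.card := by
  rw [← Finset.card_image_of_injective S Finset.singleton_injective]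
  congr 1
  ext A
  rw [mem_vertexFaces, Finset.mem_image]
  constructor
  · rintro ⟨⟨u, rfl⟩, hd⟩
    obtain ⟨v, hv⟩ := argmaxOn_nonempty hne u
    refine ⟨v, argmaxOn_subset _ _ hv, Finset.ext fun x => ?_⟩
    rw [Finset.mem_singleton]
    refine ⟨by rintro rfl; exact hv, fun hx => ?_⟩
    by_contra hxv
    exact (vdim_pos hx hv hxv).ne' hd
  · rintro ⟨v, hv, rfl⟩
    obtain ⟨u, hu⟩ := hS v hv
    refine ⟨⟨u, Finset.ext fun x => ?_⟩, by simp [vdim]⟩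
    rw [Finset.mem_singleton, mem_argmaxOn_iff_of_le hv fun t ht => ?_]
    · constructor
      · rintro rfl
        exact ⟨hv, rfl⟩
      · rintro ⟨hx, hxu⟩
        by_contra hxv
        exact (hu x hx hxv).ne hxu
    · by_cases h : t = v
      · rw [h]
      · exact (hu t ht h).le

end Hull

/-! ### Polytopes and face numbers in terms of vertex sets -/

section Faces

variable {E : Type*} [NormedAddCommGroup E] [NormedSpace ℝ E]

/-- Points in the hull of the others are discarded one by one; once none is left, Hahn–Banach
separates each point from the rest. -/
theorem IsPolytope.exists_convexPosition {P : Set E} (hP : IsPolytope P) :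
    ∃ S : Finset E, ConvexPosition S ∧ P = convexHull ℝ (S : Set E) := by
  classical
  have main : ∀ n : ℕ, ∀ T : Finset E, T.card = n →
      ∃ S : Finset E, ConvexPosition S ∧ convexHull ℝ (T : Set E) = convexHull ℝ (S : Set E) := by
    intro n
    induction n with
    | zero =>
      intro T hT
      rw [Finset.card_eq_zero] at hT
      subst hT
      exact ⟨∅, fun v hv => absurd hv (Finset.notMem_empty v), rfl⟩
    | succ n ih =>
      intro T hT
      by_cases h : ∃ v ∈ T, v ∈ convexHull ℝ ((T.erase v : Finset E) : Set E)
      · obtain ⟨v, hv, hvm⟩ := h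
        obtain ⟨S, hS, hS'⟩ := ih (T.erase v) (by rw [Finset.card_erase_of_mem hv, hT]; rfl)
        refine ⟨S, hS, hS' ▸ Set.Subset.antisymm (convexHull_min (fun x hx => ?_)
          (convex_convexHull ℝ _)) (convexHull_mono (by exact_mod_cast T.erase_subset v))⟩
        by_cases hxv : x = v
        · rwa [hxv]
        · exact subset_convexHull ℝ _ (Finset.mem_coe.2 (Finset.mem_erase.2 ⟨hxv, hx⟩))
      · push Not at h
        refine ⟨T, fun v hv => ?_, rfl⟩
        obtain ⟨f, r, hf, hr⟩ := geometric_hahn_banach_closed_point (convex_convexHull ℝ _)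
          ((T.erase v).finite_toSet.isClosed_convexHull (𝕜 := ℝ)) (h v hv)
        exact ⟨f, fun s hs hsv => (hf s (subset_convexHull ℝ _
          (Finset.mem_coe.2 (Finset.mem_erase.2 ⟨hsv, hs⟩)))).trans hr⟩
  obtain ⟨s, hs, rfl⟩ := hP
  obtain ⟨S, hS, h⟩ := main _ hs.toFinset rfl
  rw [hs.coe_toFinset] at h
  exact ⟨S, hS, h⟩

variable [FiniteDimensional ℝ E]

theorem kFaces_convexHull (k : ℕ) {S : Finset E} (hne : S.Nonempty) :
    kFaces k (convexHull ℝ (S : Set E)) =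
      (fun A : Finset E => convexHull ℝ (A : Set E)) '' (vertexFaces k S : Set (Finset E)) := by
  have key : ∀ u : Module.Dual ℝ E, convexHull ℝ (argmaxOn S u : Set E) =
      {x ∈ convexHull ℝ (S : Set E) | ∀ y ∈ convexHull ℝ (S : Set E), u y ≤ u x} := fun u => by
    ext x
    rw [mem_convexHull_argmaxOn]
    exact and_congr_right fun _ => ⟨fun h y hy => le_of_mem_convexHull h hy,
      fun h t ht => h t (subset_convexHull ℝ _ ht)⟩
  ext F
  simp only [kFaces, Set.mem_ofPred_eq, Set.mem_image, Finset.mem_coe, mem_vertexFaces]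
  constructor
  · rintro ⟨hF, hexp, hdim⟩
    obtain ⟨l, hl⟩ := hexp hF
    have hFeq : F = convexHull ℝ (argmaxOn S (l : E →ₗ[ℝ] ℝ) : Set E) := by rw [hl, key]; rfl
    refine ⟨_, ⟨⟨_, rfl⟩, ?_⟩, hFeq.symm⟩
    rw [← hdim, hFeq, convexDim, vectorSpan_convexHull]
    rfl
  · rintro ⟨_, ⟨⟨u, rfl⟩, hd⟩, rfl⟩
    refine ⟨(argmaxOn_nonempty hne u).to_set.convexHull, fun _ => ⟨u.toContinuousLinearMap, ?_⟩, ?_⟩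
    · rw [key]
      rfl
    · rw [convexDim, vectorSpan_convexHull, ← hd]
      rfl

theorem faceNumber_convexHull (k : ℕ) {S : Finset E} (hne : S.Nonempty) :
    faceNumber k (convexHull ℝ (S : Set E)) = (vertexFaces k S).card := by
  rw [faceNumber, kFaces_convexHull k hne, Set.InjOn.ncard_image, Set.ncard_coe_finset]
  intro A hA B hB hAB
  obtain ⟨⟨u, rfl⟩, -⟩ := mem_vertexFaces.1 (Finset.mem_coe.1 hA)
  obtain ⟨⟨v, rfl⟩, -⟩ := mem_vertexFaces.1 (Finset.mem_coe.1 hB)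
  dsimp only at hAB
  rw [argmaxOn_eq_filter_convexHull S u, argmaxOn_eq_filter_convexHull S v, hAB]

end Faces

/-! ### Faces of a Minkowski sum -/

section Minkowski

open scoped Classical

variable {E : Type*} [AddCommGroup E] [Module ℝ E]

/-- `S` behaves like the vertex set of the Minkowski sum of the hulls of `S₁` and `S₂`. -/
structure IsVertexSum (S S₁ S₂ : Finset E) : Prop where
  exists_add : ∀ u, ∀ s ∈ argmaxOn S u, ∃ a ∈ argmaxOn S₁ u, ∃ b ∈ argmaxOn S₂ u, a + b = s
  add_mem : ∀ u, ∀ a ∈ argmaxOn S₁ u, ∀ b ∈ argmaxOn S₂ u,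
    a + b ∈ convexHull ℝ (argmaxOn S u : Set E)

theorem isVertexSum_of_convexHull_eq {S S₁ S₂ : Finset E} (hS : ConvexPosition S)
    (h₁ : S₁.Nonempty) (h₂ : S₂.Nonempty)
    (h : convexHull ℝ (S : Set E) = convexHull ℝ (S₁ : Set E) + convexHull ℝ (S₂ : Set E)) :
    IsVertexSum S S₁ S₂ := by
  have hadd : ∀ u, ∀ a ∈ argmaxOn S₁ u, ∀ b ∈ argmaxOn S₂ u,
      a + b ∈ convexHull ℝ (argmaxOn S u : Set E) := by
    intro u a ha b hb
    rw [mem_argmaxOn] at ha hb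
    rw [mem_convexHull_argmaxOn, h]
    refine ⟨Set.add_mem_add (subset_convexHull ℝ _ ha.1) (subset_convexHull ℝ _ hb.1),
      fun t ht => ?_⟩
    have ht' : t ∈ convexHull ℝ (S : Set E) := subset_convexHull ℝ _ ht
    rw [h] at ht'
    obtain ⟨x, hx, y, hy, rfl⟩ := ht'
    rw [map_add, map_add]
    exact add_le_add (le_of_mem_convexHull ha.2 hx) (le_of_mem_convexHull hb.2 hy)
  have hmem : ∀ s ∈ S, ∃ a ∈ S₁, ∃ b ∈ S₂, a + b = s := by
    intro s hs
    obtain ⟨u, hu⟩ := hS s hs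
    obtain ⟨a, ha⟩ := argmaxOn_nonempty h₁ u
    obtain ⟨b, hb⟩ := argmaxOn_nonempty h₂ u
    refine ⟨a, argmaxOn_subset _ _ ha, b, argmaxOn_subset _ _ hb, ?_⟩
    -- The face exposed by `u` is the single point `s`, and it contains `a + b`.
    have hsing : (argmaxOn S u : Set E) ⊆ {s} := fun t ht => by
      by_contra hts
      have ht := mem_argmaxOn.1 (Finset.mem_coe.1 ht)
      exact (hu t ht.1 hts).not_ge (ht.2 s hs)
    have := convexHull_mono (𝕜 := ℝ) hsing (hadd u a ha b hb)
    simpa using this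
  refine ⟨fun u s hs => ?_, hadd⟩
  obtain ⟨a, ha, b, hb, rfl⟩ := hmem s (argmaxOn_subset _ _ hs)
  obtain ⟨a₀, ha₀⟩ := argmaxOn_nonempty h₁ u
  obtain ⟨b₀, hb₀⟩ := argmaxOn_nonempty h₂ u
  have h3 := (mem_convexHull_argmaxOn.1 (hadd u a₀ ha₀ b₀ hb₀)).2 _ (argmaxOn_subset _ _ hs)
  have h4 : u (a₀ + b₀) ≤ u (a + b) := le_of_mem_convexHull (mem_argmaxOn.1 hs).2
    (mem_convexHull_argmaxOn.1 (hadd u a₀ ha₀ b₀ hb₀)).1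
  rw [map_add, map_add] at h3 h4
  have h5 := (mem_argmaxOn.1 ha₀).2 a ha
  have h6 := (mem_argmaxOn.1 hb₀).2 b hb
  exact ⟨a, (mem_argmaxOn_iff ha₀).2 ⟨ha, by linarith⟩, b,
    (mem_argmaxOn_iff hb₀).2 ⟨hb, by linarith⟩, rfl⟩

variable {S S₁ S₂ : Finset E}

theorem IsVertexSum.symm (h : IsVertexSum S S₁ S₂) : IsVertexSum S S₂ S₁ where
  exists_add u s hs := by
    obtain ⟨a, ha, b, hb, rfl⟩ := h.exists_add u s hs
    exact ⟨b, hb, a, ha, add_comm b a⟩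
  add_mem u a ha b hb := add_comm b a ▸ h.add_mem u b hb a ha

theorem IsVertexSum.card_le (h : IsVertexSum S S₁ S₂) : S.card ≤ S₁.card * S₂.card := by
  refine (Finset.card_le_card fun s hs => ?_).trans (Finset.card_add_le (s := S₁) (t := S₂))
  obtain ⟨a, ha, b, hb, rfl⟩ := h.exists_add 0 s (by rwa [argmaxOn_zero])
  exact Finset.add_mem_add (argmaxOn_subset _ _ ha) (argmaxOn_subset _ _ hb)

theorem IsVertexSum.vectorSpan_le (h : IsVertexSum S S₁ S₂) (h₂ : S₂.Nonempty)
    (u : Module.Dual ℝ E) : vectorSpan ℝ (argmaxOn S₁ u : Set E) ≤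
      vectorSpan ℝ (argmaxOn S u : Set E) := by
  obtain ⟨b, hb⟩ := argmaxOn_nonempty h₂ u
  rw [← vectorSpan_convexHull (argmaxOn S u : Set E), vectorSpan_def ℝ (argmaxOn S₁ u : Set E),
    Submodule.span_le]
  rintro _ ⟨x, hx, y, hy, rfl⟩
  have := vsub_mem_vectorSpan ℝ (h.add_mem u x hx b hb) (h.add_mem u y hy b hb)
  simpa using this

theorem IsVertexSum.vectorSpan_eq (h : IsVertexSum S S₁ S₂) (h₁ : S₁.Nonempty)
    (h₂ : S₂.Nonempty) (u : Module.Dual ℝ E) : vectorSpan ℝ (argmaxOn S u : Set E) =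
      vectorSpan ℝ (argmaxOn S₁ u : Set E) ⊔ vectorSpan ℝ (argmaxOn S₂ u : Set E) := by
  refine le_antisymm ?_ (sup_le (h.vectorSpan_le h₂ u) (h.symm.vectorSpan_le h₁ u))
  rw [vectorSpan_def, Submodule.span_le]
  rintro _ ⟨x, hx, y, hy, rfl⟩
  obtain ⟨a, ha, b, hb, rfl⟩ := h.exists_add u x hx
  obtain ⟨a', ha', b', hb', rfl⟩ := h.exists_add u y hy
  dsimp only
  rw [vsub_eq_sub, add_sub_add_comm]
  exact Submodule.add_mem_sup (sub_mem_vectorSpan ha ha') (sub_mem_vectorSpan hb hb')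

end Minkowski

/-! ### The two upper bounds -/

section UpperBound

open scoped Classical

variable {E : Type*} [AddCommGroup E] [Module ℝ E]
variable {S S₁ S₂ : Finset E}

theorem IsVertexSum.exists_argmaxOn_argmaxOn (h : IsVertexSum S S₁ S₂) (h₀ : S.Nonempty)
    (h₁ : S₁.Nonempty) (h₂ : S₂.Nonempty) (u w : Module.Dual ℝ E) :
    ∃ s ∈ argmaxOn S u, ∃ a ∈ argmaxOn (argmaxOn S₁ u) w,
      ∃ b ∈ argmaxOn (argmaxOn S₂ u) w, a + b = s := by
  obtain ⟨K, e₀, e₁, e₂⟩ := ((eventually_argmaxOn_smul_add h₀ u w).and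
    ((eventually_argmaxOn_smul_add h₁ u w).and (eventually_argmaxOn_smul_add h₂ u w))).exists
  obtain ⟨s, hs⟩ := argmaxOn_nonempty h₀ (K • u + w)
  have := h.exists_add _ s hs
  rw [e₁, e₂] at this
  rw [e₀] at hs
  exact ⟨s, argmaxOn_subset _ _ hs, this⟩

variable [FiniteDimensional ℝ E]

/-- A facet of a sum in which both summands are at most one-dimensional is a parallelogram. -/
theorem IsVertexSum.four_le_card (h : IsVertexSum S S₁ S₂) (h₀ : S.Nonempty) (h₁ : S₁.Nonempty)
    (h₂ : S₂.Nonempty) (hS₁ : ConvexPosition S₁) (hS₂ : ConvexPosition S₂) {u : Module.Dual ℝ E}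
    (hd : vdim (argmaxOn S u) = 2) (hd₁ : vdim (argmaxOn S₁ u) ≤ 1)
    (hd₂ : vdim (argmaxOn S₂ u) ≤ 1) : 4 ≤ (argmaxOn S u).card := by
  have hsup := h.vectorSpan_eq h₁ h₂ u
  have hle : vdim (argmaxOn S u) ≤ vdim (argmaxOn S₁ u) + vdim (argmaxOn S₂ u) := by
    rw [vdim, hsup]
    exact Submodule.finrank_add_le_finrank_add_finrank _ _
  have c₁ := card_eq_two_of_edge hS₁ (mem_vertexFaces.2 ⟨⟨u, rfl⟩, by omega⟩)
  have c₂ := card_eq_two_of_edge hS₂ (mem_vertexFaces.2 ⟨⟨u, rfl⟩, by omega⟩)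
  have hpair : ∀ (A : Finset E) (x : E), A.card = 2 → x ∈ A → ∃ y, x ≠ y ∧ A = {x, y} := by
    intro A x hA hx
    obtain ⟨y, hy⟩ := Finset.card_eq_one.1
      (show (A.erase x).card = 1 by rw [Finset.card_erase_of_mem hx, hA])
    refine ⟨y, fun h => ?_, ?_⟩
    · have : y ∈ A.erase x := by simp [hy]
      exact Finset.ne_of_mem_erase this h.symm
    · rw [← hy, Finset.insert_erase hx]
  -- The two faces are segments with independent directions, so one functional can prefer any chosen
  -- end of each. Breaking ties by it shows that all four sums of endpoints are vertices.
  have claim : ∀ x ∈ argmaxOn S₁ u, ∀ y ∈ argmaxOn S₂ u, ∃ w : Module.Dual ℝ E,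
      (∀ x' ∈ argmaxOn S₁ u, x' ≠ x → w x' < w x) ∧
      ∀ y' ∈ argmaxOn S₂ u, y' ≠ y → w y' < w y := by
    intro x hx y hy
    obtain ⟨x', hxx', hA₁⟩ := hpair _ x c₁ hx
    obtain ⟨y', hyy', hA₂⟩ := hpair _ y c₂ hy
    have hv₁ : vectorSpan ℝ (argmaxOn S₁ u : Set E) = Submodule.span ℝ {x - x'} := by
      rw [hA₁, Finset.coe_pair, vectorSpan_pair, vsub_eq_sub]
    have hv₂ : vectorSpan ℝ (argmaxOn S₂ u : Set E) = Submodule.span ℝ {y - y'} := by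
      rw [hA₂, Finset.coe_pair, vectorSpan_pair, vsub_eq_sub]
    have hli : LinearIndependent ℝ ![x - x', y - y'] := by
      refine (LinearIndependent.pair_iff' (sub_ne_zero.2 hxx')).2 fun a ha => ?_
      have : vectorSpan ℝ (argmaxOn S₂ u : Set E) ≤ vectorSpan ℝ (argmaxOn S₁ u : Set E) := by
        rw [hv₁, hv₂, Submodule.span_singleton_le_iff_mem, ← ha]
        exact Submodule.smul_mem _ _ (Submodule.mem_span_singleton_self _)
      rw [vdim, hsup, sup_eq_left.2 this] at hd
      unfold vdim at hd₁
      omega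
    obtain ⟨w, hw⟩ := Module.exists_dual_forall_apply_eq_one (linearIndepOn_univ_iff.2 hli)
    have w1 := hw 0 (Set.mem_univ _)
    have w2 := hw 1 (Set.mem_univ _)
    simp only [Matrix.cons_val_zero, Matrix.cons_val_one, map_sub] at w1 w2
    refine ⟨w, fun z hz hzx => ?_, fun z hz hzy => ?_⟩
    · rw [hA₁, Finset.mem_insert, Finset.mem_singleton] at hz
      rw [hz.resolve_left hzx]
      linarith
    · rw [hA₂, Finset.mem_insert, Finset.mem_singleton] at hz
      rw [hz.resolve_left hzy]
      linarith
  have hcard : (argmaxOn S₁ u ×ˢ argmaxOn S₂ u).card = 4 := by rw [Finset.card_product, c₁, c₂]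
  rw [← hcard]
  refine Finset.card_le_card_of_injOn (fun t => t.1 + t.2) ?_ ?_
  · rintro ⟨x, y⟩ ht
    obtain ⟨hx, hy⟩ := Finset.mem_product.1 (Finset.mem_coe.1 ht)
    obtain ⟨w, hw₁, hw₂⟩ := claim x hx y hy
    obtain ⟨s, hs, a, ha, b, hb, rfl⟩ := h.exists_argmaxOn_argmaxOn h₀ h₁ h₂ u w
    rw [mem_argmaxOn] at ha hb
    have hax : a = x := by
      by_contra hne
      exact (hw₁ a ha.1 hne).not_ge (ha.2 x hx)
    have hby : b = y := by
      by_contra hne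
      exact (hw₂ b hb.1 hne).not_ge (hb.2 y hy)
    rw [hax, hby] at hs
    exact hs
  · rintro ⟨x, y⟩ ht ⟨x', y'⟩ ht' heq
    obtain ⟨hx, hy⟩ := Finset.mem_product.1 (Finset.mem_coe.1 ht)
    obtain ⟨hx', hy'⟩ := Finset.mem_product.1 (Finset.mem_coe.1 ht')
    obtain ⟨w, hw₁, hw₂⟩ := claim x hx y hy
    dsimp only at hx hy hx' hy' heq
    have e := congrArg w heq
    rw [map_add, map_add] at e
    have l₁ := hw₁ x' hx'
    have l₂ := hw₂ y' hy'
    by_cases e₁ : x' = x <;> by_cases e₂ : y' = y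
    · rw [e₁, e₂]
    · rw [e₁] at e
      linarith [l₂ e₂]
    · rw [e₂] at e
      linarith [l₁ e₁]
    · linarith [l₁ e₁, l₂ e₂]

/-- Functionals exposing the same facet of a three-dimensional summand expose the same face of
the sum. -/
theorem argmaxOn_congr_of_facet (hE : Module.finrank ℝ E = 3) (hS₁ : vdim S₁ = 3)
    {u u' : Module.Dual ℝ E} (heq : argmaxOn S₁ u = argmaxOn S₁ u')
    (hd : vdim (argmaxOn S₁ u) = 2) (T : Finset E) : argmaxOn T u = argmaxOn T u' := by
  obtain ⟨c, hc, rfl⟩ := exists_smul_eq_of_facets hE hS₁ (u := u) (u' := u') subset_rfl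
    heq.subset hd.ge (ne_zero_of_vdim_argmaxOn (S := S₁) (by omega))
    (ne_zero_of_vdim_argmaxOn (S := S₁) (by rw [← heq]; omega))
  exact (argmaxOn_smul T u hc).symm

/-- A non-parallelogram facet of the sum comes from a facet of a summand, and that facet determines
it because its normal is unique up to a positive factor. -/
theorem IsVertexSum.card_triangles_le (h : IsVertexSum S S₁ S₂) (hE : Module.finrank ℝ E = 3)
    (h₀ : S.Nonempty) (hS₁ : ConvexPosition S₁) (hS₂ : ConvexPosition S₂)
    (hd₁ : vdim S₁ = 3) (hd₂ : vdim S₂ = 3) :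
    {F ∈ vertexFaces 2 S | F.card < 4}.card ≤ (vertexFaces 2 S₁).card + (vertexFaces 2 S₂).card := by
  have h₁ : S₁.Nonempty :=
    let ⟨y, hy, _⟩ := exists_ne_of_vdim_pos (show 0 < vdim S₁ by omega) (x := (0 : E)); ⟨y, hy⟩
  have h₂ : S₂.Nonempty :=
    let ⟨y, hy, _⟩ := exists_ne_of_vdim_pos (show 0 < vdim S₂ by omega) (x := (0 : E)); ⟨y, hy⟩
  have hg : ∀ T : Finset E, ∃ g : Finset E → Finset E, ∀ F ∈ vertexFaces 2 T,
      ∃ u, F = argmaxOn T u ∧ g F = argmaxOn S u := by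
    intro T
    have : ∀ F : Finset E, ∃ G : Finset E, F ∈ vertexFaces 2 T →
        ∃ u, F = argmaxOn T u ∧ G = argmaxOn S u := fun F => by
      by_cases hF : F ∈ vertexFaces 2 T
      · obtain ⟨⟨u, hu⟩, -⟩ := mem_vertexFaces.1 hF
        exact ⟨_, fun _ => ⟨u, hu, rfl⟩⟩
      · exact ⟨∅, fun h => absurd h hF⟩
    choose g hg using this
    exact ⟨g, hg⟩
  obtain ⟨g₁, hg₁⟩ := hg S₁
  obtain ⟨g₂, hg₂⟩ := hg S₂
  have hsub : {F ∈ vertexFaces 2 S | F.card < 4} ⊆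
      (vertexFaces 2 S₁).image g₁ ∪ (vertexFaces 2 S₂).image g₂ := by
    intro F hF
    obtain ⟨hF, hcard⟩ := Finset.mem_filter.1 hF
    obtain ⟨⟨u, rfl⟩, hd⟩ := mem_vertexFaces.1 hF
    have hu : u ≠ 0 := by
      rintro rfl
      rw [argmaxOn_zero] at hd
      have := Submodule.finrank_mono (h.vectorSpan_le h₂ 0)
      rw [argmaxOn_zero, argmaxOn_zero] at this
      unfold vdim at hd hd₁
      omega
    have hlt : ∀ {T : Finset E}, T.Nonempty → vdim (argmaxOn T u) < 3 := fun hT => by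
      obtain ⟨p, hp⟩ := argmaxOn_nonempty hT u
      rw [← hE]
      exact vdim_lt_finrank hu hp fun x hx => ((mem_argmaxOn_iff hp).1 hx).2
    have l₁ := hlt h₁
    have l₂ := hlt h₂
    rw [Finset.mem_union, Finset.mem_image, Finset.mem_image]
    by_cases k₁ : vdim (argmaxOn S₁ u) = 2
    · have hm := mem_vertexFaces.2 ⟨⟨u, rfl⟩, k₁⟩
      obtain ⟨u', h1, h2⟩ := hg₁ _ hm
      exact Or.inl ⟨_, hm, h2.trans (argmaxOn_congr_of_facet hE hd₁ h1 k₁ S).symm⟩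
    by_cases k₂ : vdim (argmaxOn S₂ u) = 2
    · have hm := mem_vertexFaces.2 ⟨⟨u, rfl⟩, k₂⟩
      obtain ⟨u', h1, h2⟩ := hg₂ _ hm
      exact Or.inr ⟨_, hm, h2.trans (argmaxOn_congr_of_facet hE hd₂ h1 k₂ S).symm⟩
    · have := h.four_le_card h₀ h₁ h₂ hS₁ hS₂ hd (by omega) (by omega)
      omega
  exact (Finset.card_le_card hsub).trans ((Finset.card_union_le _ _).trans
    (add_le_add Finset.card_image_le Finset.card_image_le))

theorem card_facets_add_four_le (hE : Module.finrank ℝ E = 3) (hS : ConvexPosition S)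
    (hd : vdim S = 3) : (vertexFaces 2 S).card + 4 ≤ 2 * S.card := by
  have h1 := sum_card_facets_add_four_le hE hS hd
  have h2 : ∑ F ∈ vertexFaces 2 S, 3 ≤ ∑ F ∈ vertexFaces 2 S, F.card :=
    Finset.sum_le_sum fun F hF => by
      have hF := (mem_vertexFaces.1 hF).2
      obtain ⟨y, hy, -⟩ := exists_ne_of_vdim_pos (show 0 < vdim F by omega) (x := (0 : E))
      have := vdim_add_one_le_card ⟨y, hy⟩
      omega
  rw [Finset.sum_const, smul_eq_mul] at h2
  omega

theorem IsVertexSum.four_mul_card_facets_le (h : IsVertexSum S S₁ S₂)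
    (hE : Module.finrank ℝ E = 3) (h₀ : S.Nonempty) (hS₁ : ConvexPosition S₁)
    (hS₂ : ConvexPosition S₂) (hd₁ : vdim S₁ = 3) (hd₂ : vdim S₂ = 3) :
    4 * (vertexFaces 2 S).card + 8 ≤
      ∑ F ∈ vertexFaces 2 S, F.card + 2 * S₁.card + 2 * S₂.card := by
  have t := h.card_triangles_le hE h₀ hS₁ hS₂ hd₁ hd₂
  have f₁ := card_facets_add_four_le hE hS₁ hd₁
  have f₂ := card_facets_add_four_le hE hS₂ hd₂
  have hsum : ∑ F ∈ vertexFaces 2 S, 4 ≤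
      ∑ F ∈ vertexFaces 2 S, (F.card + if F.card < 4 then 1 else 0) :=
    Finset.sum_le_sum fun F hF => by
      have hF := (mem_vertexFaces.1 hF).2
      obtain ⟨y, hy, -⟩ := exists_ne_of_vdim_pos (show 0 < vdim F by omega) (x := (0 : E))
      have := vdim_add_one_le_card ⟨y, hy⟩
      split_ifs <;> omega
  rw [Finset.sum_add_distrib, ← Finset.card_filter, Finset.sum_const, smul_eq_mul] at hsum
  omega

theorem IsVertexSum.vdim_eq (h : IsVertexSum S S₁ S₂) (hE : Module.finrank ℝ E = 3)
    (h₂ : S₂.Nonempty) (hd₁ : vdim S₁ = 3) : vdim S = 3 := by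
  have := Submodule.finrank_mono (h.vectorSpan_le h₂ 0)
  rw [argmaxOn_zero, argmaxOn_zero] at this
  refine le_antisymm (hE ▸ Submodule.finrank_le _) ?_
  rw [← hd₁]
  exact this

theorem IsVertexSum.card_facets_add_six_le (h : IsVertexSum S S₁ S₂)
    (hE : Module.finrank ℝ E = 3) (hS : ConvexPosition S) (h₀ : S.Nonempty)
    (hS₁ : ConvexPosition S₁) (hS₂ : ConvexPosition S₂) (hd : vdim S = 3)
    (hd₁ : vdim S₁ = 3) (hd₂ : vdim S₂ = 3) :
    (vertexFaces 2 S).card + 6 ≤ S₁.card * S₂.card + S₁.card + S₂.card := by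
  have e₁ := h.four_mul_card_facets_le hE h₀ hS₁ hS₂ hd₁ hd₂
  have e₂ := sum_card_facets_add_four_le hE hS hd
  have e₃ := h.card_le
  omega

theorem IsVertexSum.card_edges_add_eight_le (h : IsVertexSum S S₁ S₂)
    (hE : Module.finrank ℝ E = 3) (hS : ConvexPosition S) (h₀ : S.Nonempty)
    (hS₁ : ConvexPosition S₁) (hS₂ : ConvexPosition S₂) (hd : vdim S = 3)
    (hd₁ : vdim S₁ = 3) (hd₂ : vdim S₂ = 3) :
    (vertexFaces 1 S).card + 8 ≤ 2 * (S₁.card * S₂.card) + S₁.card + S₂.card := by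
  have e₀ := h.card_facets_add_six_le hE hS h₀ hS₁ hS₂ hd hd₁ hd₂
  have e₂ := sum_card_facets_add_four_le hE hS hd
  have e₃ := h.card_le
  have e₄ := two_mul_card_edges hE hS hd
  omega

/-- With many facets and few triangles, Σ|F| = 2f₁ must be large. -/
theorem IsVertexSum.le_card_edges_add_eight (h : IsVertexSum S S₁ S₂)
    (hE : Module.finrank ℝ E = 3) (hS : ConvexPosition S) (h₀ : S.Nonempty)
    (hS₁ : ConvexPosition S₁) (hS₂ : ConvexPosition S₂) (hd : vdim S = 3)
    (hd₁ : vdim S₁ = 3) (hd₂ : vdim S₂ = 3)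
    (hF : S₁.card * S₂.card + S₁.card + S₂.card ≤ (vertexFaces 2 S).card + 6) :
    2 * (S₁.card * S₂.card) + S₁.card + S₂.card ≤ (vertexFaces 1 S).card + 8 := by
  have e₁ := h.four_mul_card_facets_le hE h₀ hS₁ hS₂ hd₁ hd₂
  have e₄ := two_mul_card_edges hE hS hd
  omega

end UpperBound

/-! ### Cyclic polytopes on a twisted cubic -/

section TwistedCubic

open scoped Classical

variable {E : Type*}

/-- The points of the curve `γ` at the first `n` parameters of the sequence `x`. -/
noncomputable def curvePoints (γ : ℝ → E) (x : ℕ → ℝ) (n : ℕ) : Finset E :=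
  (Finset.range n).image fun i => γ (x i)

theorem mem_curvePoints {γ : ℝ → E} {x : ℕ → ℝ} {n i : ℕ} (h : i < n) :
    γ (x i) ∈ curvePoints γ x n :=
  Finset.mem_image_of_mem (fun i => γ (x i)) (Finset.mem_range.2 h)

variable [AddCommGroup E] [Module ℝ E]

/-- `γ` is a twisted cubic: every functional is a cubic polynomial along `γ`, with coefficients
`α`, `κ`, `β` that may be prescribed and that determine the functional. -/
structure IsTwistedCubic (γ : ℝ → E) (α κ β : Module.Dual ℝ E → ℝ) : Prop where
  apply_eq : ∀ u t, u (γ t) = α u * t + κ u * t ^ 2 + β u * t ^ 3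
  surj : ∀ a k b, ∃ u, α u = a ∧ κ u = k ∧ β u = b
  inj : ∀ u, α u = 0 → κ u = 0 → β u = 0 → u = 0

variable {γ : ℝ → E} {α κ β : Module.Dual ℝ E → ℝ} {x : ℕ → ℝ}

theorem IsTwistedCubic.injective (h : IsTwistedCubic γ α κ β) : Function.Injective γ := by
  obtain ⟨u, h1, h2, h3⟩ := h.surj 1 0 0
  intro s t hst
  have := congrArg u hst
  rw [h.apply_eq, h.apply_eq, h1, h2, h3] at this
  linarith

theorem IsTwistedCubic.card_curvePoints (h : IsTwistedCubic γ α κ β) (hx : StrictMono x) (n : ℕ) :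
    (curvePoints γ x n).card = n := by
  rw [curvePoints, Finset.card_image_of_injective (f := fun i => γ (x i)) _
    (h.injective.comp hx.injective), Finset.card_range]

theorem IsTwistedCubic.convexPosition (h : IsTwistedCubic γ α κ β) (n : ℕ) :
    ConvexPosition (curvePoints γ x n) := by
  intro v hv
  obtain ⟨i, -, rfl⟩ := Finset.mem_image.1 hv
  -- Along the curve this is x_i² - (t - x_i)².
  obtain ⟨u, h1, h2, h3⟩ := h.surj (2 * x i) (-1) 0
  refine ⟨u, fun s hs hne => ?_⟩
  obtain ⟨j, -, rfl⟩ := Finset.mem_image.1 hs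
  have : x j - x i ≠ 0 := fun h => hne (by rw [sub_eq_zero.1 h])
  rw [h.apply_eq, h.apply_eq, h1, h2, h3]
  have := pow_pos (abs_pos.2 this) 2
  rw [sq_abs] at this
  nlinarith

/-- Vieta: after subtraction of the common value, the cubic is β(t - p)(t - q)(t - r). -/
theorem IsTwistedCubic.coeff_eq (h : IsTwistedCubic γ α κ β) {u : Module.Dual ℝ E} {p q r : ℝ}
    (hpq : p ≠ q) (hpr : p ≠ r) (hqr : q ≠ r) (h1 : u (γ q) = u (γ p)) (h2 : u (γ r) = u (γ p)) :
    κ u = -β u * (p + q + r) ∧ α u = β u * (p * q + p * r + q * r) := by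
  rw [h.apply_eq, h.apply_eq] at h1 h2
  have e1 : α u + κ u * (q + p) + β u * (q ^ 2 + q * p + p ^ 2) = 0 :=
    mul_left_cancel₀ (sub_ne_zero.2 hpq.symm) (by linear_combination h1)
  have e2 : α u + κ u * (r + p) + β u * (r ^ 2 + r * p + p ^ 2) = 0 :=
    mul_left_cancel₀ (sub_ne_zero.2 hpr.symm) (by linear_combination h2)
  have e3 : κ u + β u * (p + q + r) = 0 :=
    mul_left_cancel₀ (sub_ne_zero.2 hqr) (by linear_combination e1 - e2)
  exact ⟨by linarith, by linear_combination e1 - (q + p) * e3⟩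

theorem argmaxOn_curvePoints {n : ℕ} {u : Module.Dual ℝ E} {I : Finset ℕ} (hI : I ⊆ Finset.range n)
    (hne : I.Nonempty) {M : ℝ} (hle : ∀ k < n, u (γ (x k)) ≤ M)
    (hiff : ∀ k < n, u (γ (x k)) = M ↔ k ∈ I) :
    argmaxOn (curvePoints γ x n) u = I.image fun i => γ (x i) := by
  obtain ⟨p, hp⟩ := hne
  have hpn := Finset.mem_range.1 (hI hp)
  have hpM := (hiff p hpn).2 hp
  ext s
  rw [mem_argmaxOn_iff_of_le (mem_curvePoints hpn) fun t ht => ?_, hpM]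
  · constructor
    · rintro ⟨hs, hu⟩
      obtain ⟨k, hk, rfl⟩ := Finset.mem_image.1 hs
      exact Finset.mem_image.2 ⟨k, (hiff k (Finset.mem_range.1 hk)).1 hu, rfl⟩
    · intro hs
      obtain ⟨k, hk, rfl⟩ := Finset.mem_image.1 hs
      have hkn := Finset.mem_range.1 (hI hk)
      exact ⟨mem_curvePoints hkn, (hiff k hkn).2 hk⟩
  · obtain ⟨k, hk, rfl⟩ := Finset.mem_image.1 ht
    rw [hpM]
    exact hle k (Finset.mem_range.1 hk)

section FiniteDimensional

variable [FiniteDimensional ℝ E]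

theorem vdim_eq_finrank {A : Finset E} {p : E} (hp : p ∈ A)
    (h : ∀ u : Module.Dual ℝ E, (∀ y ∈ A, u y = u p) → u = 0) : vdim A = Module.finrank ℝ E := by
  have hbot : (vectorSpan ℝ (A : Set E)).dualAnnihilator = ⊥ :=
    (Submodule.eq_bot_iff _).2 fun u hu => h u ((mem_dualAnnihilator_vectorSpan hp).1 hu)
  rw [← finrank_dualAnnihilator_vectorSpan A, hbot, finrank_bot, add_zero]

theorem IsTwistedCubic.vdim_curvePoints (h : IsTwistedCubic γ α κ β) (hx : StrictMono x) {n : ℕ}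
    (hn : 4 ≤ n) : vdim (curvePoints γ x n) = Module.finrank ℝ E := by
  refine vdim_eq_finrank (mem_curvePoints (show 0 < n by omega)) fun u hu => ?_
  have ne : ∀ {i j : ℕ}, i ≠ j → x i ≠ x j := fun hij => hx.injective.ne hij
  have e : ∀ i, i < n → u (γ (x i)) = u (γ (x 0)) := fun i hi => hu _ (mem_curvePoints hi)
  obtain ⟨k1, a1⟩ := h.coeff_eq (ne (show 0 ≠ 1 by simp)) (ne (show 0 ≠ 2 by simp))
    (ne (show 1 ≠ 2 by simp)) (e 1 (by omega)) (e 2 (by omega))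
  obtain ⟨k2, -⟩ := h.coeff_eq (ne (show 0 ≠ 1 by simp)) (ne (show 0 ≠ 3 by simp))
    (ne (show 1 ≠ 3 by simp)) (e 1 (by omega)) (e 3 (by omega))
  have hβ : β u = 0 := by
    refine (mul_eq_zero.1 (?_ : β u * (x 3 - x 2) = 0)).resolve_right
      (sub_ne_zero.2 (ne (by simp)))
    linear_combination k2 - k1
  rw [hβ] at k1 a1
  exact h.inj u (by simpa using a1) (by simpa using k1) hβ

theorem IsTwistedCubic.two_le_vdim (h : IsTwistedCubic γ α κ β) {A : Finset E} {p q r : ℝ}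
    (hpq : p ≠ q) (hpr : p ≠ r) (hqr : q ≠ r) (hp : γ p ∈ A) (hq : γ q ∈ A) (hr : γ r ∈ A) :
    2 ≤ vdim A := by
  refine two_le_finrank (sub_mem_vectorSpan hq hp) (sub_mem_vectorSpan hr hp) fun a b hab => ?_
  obtain ⟨u, u1, u2, u3⟩ := h.surj 1 0 0
  obtain ⟨v, v1, v2, v3⟩ := h.surj 0 1 0
  have e1 := congrArg u hab
  have e2 := congrArg v hab
  simp only [map_add, map_smul, map_sub, map_zero, h.apply_eq, u1, u2, u3, v1, v2, v3,
    smul_eq_mul] at e1 e2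
  have ha : a * ((q - p) * (q - r)) = 0 := by linear_combination e2 - (r + p) * e1
  have hb : b * ((r - p) * (r - q)) = 0 := by linear_combination e2 - (q + p) * e1
  exact ⟨(mul_eq_zero.1 ha).resolve_right
      (mul_ne_zero (sub_ne_zero.2 hpq.symm) (sub_ne_zero.2 hqr)),
    (mul_eq_zero.1 hb).resolve_right
      (mul_ne_zero (sub_ne_zero.2 hpr.symm) (sub_ne_zero.2 hqr.symm))⟩

theorem vdim_argmaxOn_le_two (hE : Module.finrank ℝ E = 3) {T : Finset E} (hT : T.Nonempty)
    {u : Module.Dual ℝ E} (hu : u ≠ 0) : vdim (argmaxOn T u) ≤ 2 := by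
  obtain ⟨p, hp⟩ := argmaxOn_nonempty hT u
  have := vdim_lt_finrank hu hp fun x hx => ((mem_argmaxOn_iff hp).1 hx).2
  omega

/-- Three parameters span a facet if the cubic vanishing at them has constant sign `-σ`. -/
theorem IsTwistedCubic.image_mem_facets (h : IsTwistedCubic γ α κ β)
    (hE : Module.finrank ℝ E = 3) (hx : StrictMono x) {n i j k : ℕ} (hij : i < j) (hjk : j < k)
    (hk : k < n) {σ : ℝ} (hσ : σ ≠ 0)
    (hle : ∀ m < n, 0 ≤ σ * ((x m - x i) * (x m - x j) * (x m - x k))) :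
    ({i, j, k} : Finset ℕ).image (fun i => γ (x i)) ∈ vertexFaces 2 (curvePoints γ x n) := by
  -- The coefficients of -σ(t - x_i)(t - x_j)(t - x_k) without its constant term.
  obtain ⟨u, h1, h2, h3⟩ := h.surj (-σ * (x i * x j + x i * x k + x j * x k))
    (σ * (x i + x j + x k)) (-σ)
  have hval : ∀ m, u (γ (x m)) =
      -(σ * (x i * x j * x k)) - σ * ((x m - x i) * (x m - x j) * (x m - x k)) := fun m => by
    rw [h.apply_eq, h1, h2, h3]
    ring
  have harg : argmaxOn (curvePoints γ x n) u = ({i, j, k} : Finset ℕ).image fun i => γ (x i) := by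
    refine argmaxOn_curvePoints (M := -(σ * (x i * x j * x k))) ?_ ⟨i, by simp⟩
      (fun m hm => ?_) fun m hm => ?_
    · simp only [Finset.insert_subset_iff, Finset.singleton_subset_iff, Finset.mem_range]
      omega
    · rw [hval]
      linarith [hle m hm]
    · rw [hval, sub_eq_self, mul_eq_zero, or_iff_right hσ, mul_eq_zero, mul_eq_zero]
      simp [sub_eq_zero, hx.injective.eq_iff, or_assoc]
  refine mem_vertexFaces.2 ⟨⟨u, harg.symm⟩, ?_⟩
  have hu : u ≠ 0 := by
    rintro rfl
    -- Linearity of β is not part of `IsTwistedCubic`; β 0 = 0 follows since the root sums 3 and 4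
    -- give κ 0 = -3β 0 = -4β 0.
    have e : ∀ m, (0 : Module.Dual ℝ E) (γ (x m)) = 0 := fun m => rfl
    have c := h.coeff_eq (u := 0) (p := 0) (q := 1) (r := 2) (by norm_num) (by norm_num)
      (by norm_num) rfl rfl
    have c' := h.coeff_eq (u := 0) (p := 0) (q := 1) (r := 3) (by norm_num) (by norm_num)
      (by norm_num) rfl rfl
    have : β 0 = 0 := by linarith [c.1, c'.1]
    rw [h3] at this
    exact hσ (neg_eq_zero.1 this)
  have h2' := vdim_argmaxOn_le_two hE ⟨_, mem_curvePoints (γ := γ) (x := x) hk⟩ hu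
  rw [harg] at h2'
  refine le_antisymm h2' (h.two_le_vdim (hx hij).ne (hx (hij.trans hjk)).ne (hx hjk).ne ?_ ?_ ?_)
  all_goals exact Finset.mem_image.2 ⟨_, by simp, rfl⟩

/-- The facets given by Gale's evenness condition. -/
theorem IsTwistedCubic.le_card_facets (h : IsTwistedCubic γ α κ β)
    (hE : Module.finrank ℝ E = 3) (hx : StrictMono x) {n : ℕ} (hn : 4 ≤ n) :
    2 * n ≤ (vertexFaces 2 (curvePoints γ x n)).card + 4 := by
  -- An adjacent pair of parameters with the first or with the last one: n - 2 facets of each kind,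
  -- all distinct as n ≥ 4.
  let f₁ : ℕ → Finset ℕ := fun i => {0, i + 1, i + 2}
  let f₂ : ℕ → Finset ℕ := fun i => {i, i + 1, n - 1}
  have hmono := hx.monotone
  have adj : ∀ m i, 0 ≤ (x m - x i) * (x m - x (i + 1)) := fun m i => by
    rcases le_or_gt m i with h | h
    · exact mul_nonneg_of_nonpos_of_nonpos (sub_nonpos.2 (hmono h))
        (sub_nonpos.2 (hmono (by omega)))
    · exact mul_nonneg (sub_nonneg.2 (hmono h.le)) (sub_nonneg.2 (hmono h))
  have hsub : ((Finset.range (n - 2)).image f₁ ∪ (Finset.range (n - 2)).image f₂).image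
      (fun I => I.image fun i => γ (x i)) ⊆ vertexFaces 2 (curvePoints γ x n) := by
    intro F hF
    obtain ⟨I, hI, rfl⟩ := Finset.mem_image.1 hF
    rcases Finset.mem_union.1 hI with hI | hI
    · obtain ⟨i, hi, rfl⟩ := Finset.mem_image.1 hI
      rw [Finset.mem_range] at hi
      refine h.image_mem_facets hE hx (by omega) (by omega) (by omega) one_ne_zero fun m hm => ?_
      rw [one_mul, mul_assoc]
      exact mul_nonneg (sub_nonneg.2 (hmono m.zero_le)) (adj m (i + 1))
    · obtain ⟨i, hi, rfl⟩ := Finset.mem_image.1 hI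
      rw [Finset.mem_range] at hi
      refine h.image_mem_facets hE hx (by omega) (by omega) (by omega) (σ := -1) (by norm_num)
        fun m hm => ?_
      have : x m - x (n - 1) ≤ 0 := sub_nonpos.2 (hmono (by omega))
      linarith [mul_nonpos_of_nonneg_of_nonpos (adj m i) this]
  have hinj : Function.Injective fun I : Finset ℕ => I.image fun i => γ (x i) :=
    Finset.image_injective (h.injective.comp hx.injective)
  have hcard := Finset.card_le_card hsub
  rw [Finset.card_image_of_injective _ hinj, Finset.card_union_of_disjoint ?_,
    Finset.card_image_of_injOn, Finset.card_image_of_injOn, Finset.card_range] at hcard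
  · omega
  · intro i hi j hj hij
    rw [Finset.coe_range, Set.mem_Iio] at hi hj
    have e1 := Finset.ext_iff.1 hij i
    have e2 := Finset.ext_iff.1 hij j
    simp only [f₂, Finset.mem_insert, Finset.mem_singleton, true_or, true_iff,
      iff_true] at e1 e2
    omega
  · intro i hi j hj hij
    have e1 := Finset.ext_iff.1 hij (i + 2)
    have e2 := Finset.ext_iff.1 hij (j + 2)
    simp only [f₁, Finset.mem_insert, Finset.mem_singleton, or_true, true_iff,
      iff_true] at e1 e2
    omega
  · rw [Finset.disjoint_left]
    intro I hI hI'
    obtain ⟨i, hi, rfl⟩ := Finset.mem_image.1 hI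
    obtain ⟨j, hj, hij⟩ := Finset.mem_image.1 hI'
    rw [Finset.mem_range] at hi hj
    have e1 := Finset.ext_iff.1 hij 0
    have e2 := Finset.ext_iff.1 hij 1
    have e3 := Finset.ext_iff.1 hij (n - 1)
    have e4 := Finset.ext_iff.1 hij (i + 1)
    have e5 := Finset.ext_iff.1 hij (i + 2)
    simp only [f₁, f₂, Finset.mem_insert, Finset.mem_singleton, true_or, or_true, true_iff,
      iff_true] at e1 e2 e3 e4 e5
    omega

end FiniteDimensional

end TwistedCubic

/-! ### Pairs of edges exposed by a common functional -/

section Crossing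

open scoped Classical

variable {E : Type*} [AddCommGroup E] [Module ℝ E]
variable {γ : ℝ → E} {α κ β : Module.Dual ℝ E → ℝ} {x : ℕ → ℝ}

/-- The choice of `a` makes the cubic, up to a constant, -σ(t - x_i)(t - x_j)(1 + b(t + x_i + x_j)).
The last factor is positive since the parameter sum lies in [0, 3] and b ≥ -1/4 > -1/3. -/
theorem IsTwistedCubic.argmaxOn_eq_pair (h : IsTwistedCubic γ α κ β) (hx : StrictMono x)
    (hx0 : ∀ i, 0 ≤ x i) (hx1 : ∀ i, x i ≤ 1) {n i j : ℕ} (hij : i < j) (hj : j < n) {σ a b : ℝ}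
    (hσ0 : σ ≠ 0) (hσ : ∀ m < n, 0 ≤ σ * ((x m - x i) * (x m - x j)))
    (hb : -(1 / 4) ≤ b)
    (ha : a = -(x i + x j) - b * (x i ^ 2 + x i * x j + x j ^ 2)) {u : Module.Dual ℝ E}
    (hα : α u = -σ * a) (hκ : κ u = -σ) (hβ : β u = -σ * b) :
    argmaxOn (curvePoints γ x n) u = ({i, j} : Finset ℕ).image fun i => γ (x i) := by
  have hval : ∀ m, u (γ (x m)) = u (γ (x i)) -
      σ * ((x m - x i) * (x m - x j)) * (1 + b * (x m + x i + x j)) := fun m => by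
    rw [h.apply_eq, h.apply_eq, hα, hκ, hβ, ha]
    ring
  have hpos : ∀ m, 0 < 1 + b * (x m + x i + x j) := fun m => by
    nlinarith [hx0 m, hx0 i, hx0 j, hx1 m, hx1 i, hx1 j]
  refine argmaxOn_curvePoints (M := u (γ (x i))) ?_ ⟨i, by simp⟩ (fun m hm => ?_) fun m hm => ?_
  · simp only [Finset.insert_subset_iff, Finset.singleton_subset_iff, Finset.mem_range]
    omega
  · rw [hval m]
    linarith [mul_nonneg (hσ m hm) (hpos m).le]
  · rw [hval m, sub_eq_self, mul_eq_zero, or_iff_left (hpos m).ne', mul_eq_zero, or_iff_right hσ0,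
      mul_eq_zero]
    simp [sub_eq_zero, hx.injective.eq_iff]

/-- Here `c` and `d` are elementary symmetric functions of three parameters in [0, 1]. The bound on
`d` later rules out that one direction exposes facets of both summands. -/
theorem IsTwistedCubic.exists_coeff_of_two_lt_card (h : IsTwistedCubic γ α κ β)
    (hx0 : ∀ i, 0 ≤ x i) (hx1 : ∀ i, x i ≤ 1) {n : ℕ} {u : Module.Dual ℝ E}
    (hcard : 2 < (argmaxOn (curvePoints γ x n) u).card) :
    ∃ c d : ℝ, κ u = -β u * c ∧ α u = β u * d ∧ 0 ≤ d ∧ d ≤ 3 := by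
  obtain ⟨p, hp, q, hq, r, hr, hpq, hpr, hqr⟩ := Finset.two_lt_card.1 hcard
  have e1 := ((mem_argmaxOn_iff hp).1 hq).2
  have e2 := ((mem_argmaxOn_iff hp).1 hr).2
  obtain ⟨i, -, rfl⟩ := Finset.mem_image.1 (argmaxOn_subset _ _ hp)
  obtain ⟨j, -, rfl⟩ := Finset.mem_image.1 (argmaxOn_subset _ _ hq)
  obtain ⟨k, -, rfl⟩ := Finset.mem_image.1 (argmaxOn_subset _ _ hr)
  obtain ⟨h1, h2⟩ := h.coeff_eq (fun h => hpq (by rw [h])) (fun h => hpr (by rw [h]))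
    (fun h => hqr (by rw [h])) e1 e2
  refine ⟨_, _, h1, h2, ?_, ?_⟩
  · have := hx0 i; have := hx0 j; have := hx0 k
    positivity
  · have b1 := mul_le_one₀ (hx1 i) (hx0 j) (hx1 j)
    have b2 := mul_le_one₀ (hx1 i) (hx0 k) (hx1 k)
    have b3 := mul_le_one₀ (hx1 j) (hx0 k) (hx1 k)
    linarith

variable {γ₁ γ₂ : ℝ → E} {α₁ α₂ β₁ β₂ : Module.Dual ℝ E → ℝ}

/-- Two edges, one of each curve polytope, over which the corresponding quadratics have the same
constant sign, are exposed by a common functional. -/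
theorem exists_crossing (h₁ : IsTwistedCubic γ₁ α₁ κ β₁) (h₂ : IsTwistedCubic γ₂ α₂ κ β₂)
    (hβ₁ : ∀ u, β₁ u = α₂ u / 100) (hβ₂ : ∀ u, β₂ u = α₁ u / 100) (hx : StrictMono x)
    (hx0 : ∀ i, 0 ≤ x i) (hx1 : ∀ i, x i ≤ 1) {n₁ n₂ i j k l : ℕ} (hij : i < j) (hj : j < n₁)
    (hkl : k < l) (hl : l < n₂) {σ : ℝ} (hσ0 : σ ≠ 0)
    (hσ₁ : ∀ m < n₁, 0 ≤ σ * ((x m - x i) * (x m - x j)))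
    (hσ₂ : ∀ m < n₂, 0 ≤ σ * ((x m - x k) * (x m - x l))) :
    ∃ u, argmaxOn (curvePoints γ₁ x n₁) u = ({i, j} : Finset ℕ).image (fun i => γ₁ (x i)) ∧
      argmaxOn (curvePoints γ₂ x n₂) u = ({k, l} : Finset ℕ).image (fun i => γ₂ (x i)) := by
  have bd : ∀ i j, 0 ≤ x i + x j ∧ x i + x j ≤ 2 ∧ 0 ≤ x i ^ 2 + x i * x j + x j ^ 2 ∧
      x i ^ 2 + x i * x j + x j ^ 2 ≤ 3 := fun i j => by
    have := hx0 i; have := hx0 j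
    have b1 := mul_le_one₀ (hx1 i) (hx0 j) (hx1 j)
    have b2 := pow_le_one₀ (n := 2) (hx0 i) (hx1 i)
    have b3 := pow_le_one₀ (n := 2) (hx0 j) (hx1 j)
    exact ⟨by positivity, by linarith [hx1 i, hx1 j], by positivity, by linarith⟩
  obtain ⟨A0, A2, B0, B3⟩ := bd i j
  obtain ⟨C0, C2, D0, D3⟩ := bd k l
  set A := x i + x j with hA
  set B := x i ^ 2 + x i * x j + x j ^ 2 with hB
  set C := x k + x l with hC
  set D := x k ^ 2 + x k * x l + x l ^ 2 with hD
  have hBD : B * D ≤ 9 := by nlinarith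
  have hΔ : 0 < 1 - B * D / 10000 := by linarith
  -- Equal values at the ends of both edges amount to the linear system a = -A - bB/100, b = -C -
  -- aD/100, solved by Cramer's rule. The weight 1/100 keeps its determinant positive and the cubic
  -- terms harmless.
  obtain ⟨a, ha⟩ : ∃ a, a * (1 - B * D / 10000) = B * C / 100 - A :=
    ⟨_, div_mul_cancel₀ _ hΔ.ne'⟩
  obtain ⟨b, hb⟩ : ∃ b, b * (1 - B * D / 10000) = A * D / 100 - C :=
    ⟨_, div_mul_cancel₀ _ hΔ.ne'⟩
  have hab : a = -A - b / 100 * B := mul_right_cancel₀ hΔ.ne' (by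
    linear_combination ha + B / 100 * hb)
  have hba : b = -C - a / 100 * D := mul_right_cancel₀ hΔ.ne' (by
    linear_combination hb + D / 100 * ha)
  have low : ∀ y z : ℝ, y * (1 - B * D / 10000) = z → -2 ≤ z → -3 ≤ y := by
    intro y z hy hz
    by_contra! hc
    nlinarith
  have ha3 := low a _ ha (by nlinarith [mul_nonneg B0 C0])
  have hb3 := low b _ hb (by nlinarith [mul_nonneg A0 D0])
  obtain ⟨u, u1, u2, u3⟩ := h₁.surj (-σ * a) (-σ) (-σ * (b / 100))
  have v1 : α₂ u = -σ * b := by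
    have := hβ₁ u
    rw [u3] at this
    linarith
  have v3 : β₂ u = -σ * (a / 100) := by
    rw [hβ₂, u1]
    ring
  exact ⟨u, h₁.argmaxOn_eq_pair hx hx0 hx1 hij hj hσ0 hσ₁ (by linarith) hab u1 u2 u3,
    h₂.argmaxOn_eq_pair hx hx0 hx1 hkl hl hσ0 hσ₂ (by linarith) hba v1 u2 v3⟩

/-- The edges are not parallel: in the coordinates α₁ and α₂ they are nearly orthogonal, and their
determinant is positive. -/
theorem two_le_finrank_of_crossing (h₁ : IsTwistedCubic γ₁ α₁ κ β₁)
    (h₂ : IsTwistedCubic γ₂ α₂ κ β₂) (hβ₁ : ∀ u, β₁ u = α₂ u / 100)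
    (hβ₂ : ∀ u, β₂ u = α₁ u / 100) [FiniteDimensional ℝ E] {D : Submodule ℝ E} {p q r s : ℝ}
    (hp : p ∈ Set.Icc (0 : ℝ) 1) (hq : q ∈ Set.Icc (0 : ℝ) 1) (hr : r ∈ Set.Icc (0 : ℝ) 1)
    (hs : s ∈ Set.Icc (0 : ℝ) 1) (hpq : p < q) (hrs : r < s) (hD₁ : γ₁ q - γ₁ p ∈ D)
    (hD₂ : γ₂ s - γ₂ r ∈ D) : 2 ≤ Module.finrank ℝ D := by
  refine two_le_finrank hD₁ hD₂ fun a b hab => ?_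
  obtain ⟨u, u1, u2, u3⟩ := h₁.surj 1 0 0
  obtain ⟨v, v1, v2, v3⟩ := h₁.surj 0 0 (1 / 100)
  have u4 : α₂ u = 0 := by linarith [hβ₁ u]
  have v4 : α₂ v = 1 := by linarith [hβ₁ v]
  have e1 := congrArg u hab
  have e2 := congrArg v hab
  simp only [map_add, map_smul, map_sub, map_zero, h₁.apply_eq, h₂.apply_eq, u1, u2, u3, u4, v1,
    v2, v3, v4, hβ₂, smul_eq_mul] at e1 e2
  obtain ⟨p0, p1⟩ := hp
  obtain ⟨q0, q1⟩ := hq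
  obtain ⟨r0, r1⟩ := hr
  obtain ⟨s0, s1⟩ := hs
  have bd : ∀ p q : ℝ, 0 ≤ p → 0 ≤ q → p ≤ 1 → q ≤ 1 →
      0 ≤ p ^ 2 + p * q + q ^ 2 ∧ p ^ 2 + p * q + q ^ 2 ≤ 3 := fun p q p0 q0 p1 q1 => by
    have b1 := mul_le_one₀ p1 q0 q1
    have b2 := pow_le_one₀ (n := 2) p0 p1
    have b3 := pow_le_one₀ (n := 2) q0 q1
    exact ⟨by positivity, by linarith⟩
  obtain ⟨B0, B3⟩ := bd p q p0 q0 p1 q1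
  obtain ⟨C0, C3⟩ := bd r s r0 s0 r1 s1
  have hBC : (p ^ 2 + p * q + q ^ 2) * (r ^ 2 + r * s + s ^ 2) ≤ 9 := by
    nlinarith [mul_le_mul B3 C3 C0 (by norm_num)]
  have hΔ : 0 < (q - p) * (s - r) *
      (1 - (p ^ 2 + p * q + q ^ 2) * (r ^ 2 + r * s + s ^ 2) / 10000) :=
    mul_pos (mul_pos (sub_pos.2 hpq) (sub_pos.2 hrs)) (by linarith)
  constructor
  · refine (mul_eq_zero.1 (?_ : a * ((q - p) * (s - r) *
      (1 - (p ^ 2 + p * q + q ^ 2) * (r ^ 2 + r * s + s ^ 2) / 10000)) = 0)).resolve_right hΔ.ne'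
    linear_combination (s - r) * e1 - (s ^ 3 - r ^ 3) / 100 * e2
  · refine (mul_eq_zero.1 (?_ : b * ((q - p) * (s - r) *
      (1 - (p ^ 2 + p * q + q ^ 2) * (r ^ 2 + r * s + s ^ 2) / 10000)) = 0)).resolve_right hΔ.ne'
    linear_combination (q - p) * e2 - (q ^ 3 - p ^ 3) / 100 * e1

theorem three_le_card_of_mem_facets {S F : Finset E} (hF : F ∈ vertexFaces 2 S) : 2 < F.card := by
  have hd := (mem_vertexFaces.1 hF).2
  obtain ⟨y, hy, -⟩ := exists_ne_of_vdim_pos (show 0 < vdim F by omega) (x := (0 : E))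
  have := vdim_add_one_le_card ⟨y, hy⟩
  omega

variable [FiniteDimensional ℝ E]

/-- The facets of the sum of the two curve polytopes. -/
theorem le_card_facets_curve_sum (hE : Module.finrank ℝ E = 3)
    (h₁ : IsTwistedCubic γ₁ α₁ κ β₁) (h₂ : IsTwistedCubic γ₂ α₂ κ β₂)
    (hβ₁ : ∀ u, β₁ u = α₂ u / 100) (hβ₂ : ∀ u, β₂ u = α₁ u / 100) (hx : StrictMono x)
    (hx0 : ∀ i, 0 ≤ x i) (hx1 : ∀ i, x i ≤ 1) {n₁ n₂ : ℕ} (hn₁ : 4 ≤ n₁) (hn₂ : 4 ≤ n₂)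
    {S : Finset E} (h : IsVertexSum S (curvePoints γ₁ x n₁) (curvePoints γ₂ x n₂))
    (hne : S.Nonempty) :
    n₁ * n₂ + n₁ + n₂ ≤ (vertexFaces 2 S).card + 6 := by
  set S₁ := curvePoints γ₁ x n₁ with hS₁
  set S₂ := curvePoints γ₂ x n₂ with hS₂
  have ne₁ : S₁.Nonempty := ⟨_, mem_curvePoints (show 0 < n₁ by omega)⟩
  have ne₂ : S₂.Nonempty := ⟨_, mem_curvePoints (show 0 < n₂ by omega)⟩
  have d₁ : vdim S₁ = 3 := (h₁.vdim_curvePoints hx hn₁).trans hE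
  have d₂ : vdim S₂ = 3 := (h₂.vdim_curvePoints hx hn₂).trans hE
  have d : vdim S = 3 := h.vdim_eq hE ne₂ d₁
  -- A facet of the sum determines the pair of faces it comes from, so it suffices to find many such
  -- pairs.
  set Q : Finset (Finset E × Finset E) := {t ∈ S₁.powerset ×ˢ S₂.powerset |
    ∃ u, vdim (argmaxOn S u) = 2 ∧ t = (argmaxOn S₁ u, argmaxOn S₂ u)} with hQ
  have memQ : ∀ u, vdim (argmaxOn S u) = 2 → (argmaxOn S₁ u, argmaxOn S₂ u) ∈ Q := fun u hu =>
    Finset.mem_filter.2 ⟨Finset.mem_product.2 ⟨Finset.mem_powerset.2 (argmaxOn_subset _ _),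
      Finset.mem_powerset.2 (argmaxOn_subset _ _)⟩, u, hu, rfl⟩
  have hQle : Q.card ≤ (vertexFaces 2 S).card := by
    refine Finset.card_le_card_of_forall_subsingleton
      (fun t F => ∃ u, F = argmaxOn S u ∧ t = (argmaxOn S₁ u, argmaxOn S₂ u)) ?_ ?_
    · intro t ht
      obtain ⟨-, u, hu, htu⟩ := Finset.mem_filter.1 ht
      exact ⟨_, mem_vertexFaces.2 ⟨⟨u, rfl⟩, hu⟩, u, rfl, htu⟩
    · rintro F hF t ⟨-, u, hFu, rfl⟩ t' ⟨-, u', hFu', rfl⟩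
      have hd := (mem_vertexFaces.1 hF).2
      rw [hFu] at hd
      have key := argmaxOn_congr_of_facet hE d (hFu.symm.trans hFu') hd
      rw [key S₁, key S₂]
  have two_le : ∀ {u : Module.Dual ℝ E}, 2 ≤ vdim (argmaxOn S u) → u ≠ 0 →
      vdim (argmaxOn S u) = 2 := fun hu hu0 => le_antisymm (vdim_argmaxOn_le_two hE hne hu0) hu
  have q₁ : (vertexFaces 2 S₁).card ≤ {t ∈ Q | t.1 ∈ vertexFaces 2 S₁}.card := by
    refine Finset.card_le_card_of_forall_subsingleton (fun F t => t.1 = F) ?_ ?_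
    · intro F hF
      obtain ⟨⟨u, hu⟩, hd⟩ := mem_vertexFaces.1 hF
      refine ⟨_, Finset.mem_filter.2 ⟨memQ u (two_le ?_ ?_), hu ▸ hF⟩, hu.symm⟩
      · rw [← hd, hu]
        exact Submodule.finrank_mono (h.vectorSpan_le ne₂ u)
      · exact ne_zero_of_vdim_argmaxOn (S := S₁) (by rw [← hu]; omega)
    · rintro t - F ⟨-, rfl⟩ F' ⟨-, rfl⟩
      rfl
  have q₂ : (vertexFaces 2 S₂).card ≤ {t ∈ Q | t.2 ∈ vertexFaces 2 S₂}.card := by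
    refine Finset.card_le_card_of_forall_subsingleton (fun F t => t.2 = F) ?_ ?_
    · intro F hF
      obtain ⟨⟨u, hu⟩, hd⟩ := mem_vertexFaces.1 hF
      refine ⟨_, Finset.mem_filter.2 ⟨memQ u (two_le ?_ ?_), hu ▸ hF⟩, hu.symm⟩
      · rw [← hd, hu]
        exact Submodule.finrank_mono (h.symm.vectorSpan_le ne₁ u)
      · exact ne_zero_of_vdim_argmaxOn (S := S₂) (by rw [← hu]; omega)
    · rintro t - F ⟨-, rfl⟩ F' ⟨-, rfl⟩
      rfl
  -- Pairs of consecutive-point edges have σ = 1; the extra pair, joining first and last points, has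
  -- σ = -1.
  have q₃ : (n₁ - 1) * (n₂ - 1) + 1 ≤ {t ∈ Q | t.1.card = 2 ∧ t.2.card = 2}.card := by
    let f : ℕ × ℕ → Finset ℕ × Finset ℕ := fun t => ({t.1, t.1 + 1}, {t.2, t.2 + 1})
    let g : Finset ℕ × Finset ℕ → Finset E × Finset E :=
      Prod.map (fun I => I.image fun i => γ₁ (x i)) (fun I => I.image fun i => γ₂ (x i))
    have hg : Function.Injective g :=
      (Finset.image_injective (h₁.injective.comp hx.injective)).prodMap
        (Finset.image_injective (h₂.injective.comp hx.injective))
    have hf : Function.Injective f := by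
      have : ∀ i j : ℕ, ({i, i + 1} : Finset ℕ) = {j, j + 1} → i = j := fun i j hij => by
        have e1 := Finset.ext_iff.1 hij i
        have e2 := Finset.ext_iff.1 hij j
        simp only [Finset.mem_insert, Finset.mem_singleton, true_or, true_iff, iff_true] at e1 e2
        omega
      rintro ⟨i, k⟩ ⟨j, l⟩ hh
      exact Prod.ext (this _ _ (congrArg Prod.fst hh)) (this _ _ (congrArg Prod.snd hh))
    have hmono := hx.monotone
    have adj : ∀ m i, 0 ≤ (x m - x i) * (x m - x (i + 1)) := fun m i => by
      rcases le_or_gt m i with h | h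
      · exact mul_nonneg_of_nonpos_of_nonpos (sub_nonpos.2 (hmono h))
          (sub_nonpos.2 (hmono (by omega)))
      · exact mul_nonneg (sub_nonneg.2 (hmono h.le)) (sub_nonneg.2 (hmono h))
    have ends : ∀ n, ∀ m < n, (x m - x 0) * (x m - x (n - 1)) ≤ 0 := fun n m hm =>
      mul_nonpos_of_nonneg_of_nonpos (sub_nonneg.2 (hmono m.zero_le))
        (sub_nonpos.2 (hmono (by omega)))
    have hmem : ∀ {i j k l : ℕ} {σ : ℝ}, i < j → j < n₁ → k < l → l < n₂ → σ ≠ 0 →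
        (∀ m < n₁, 0 ≤ σ * ((x m - x i) * (x m - x j))) →
        (∀ m < n₂, 0 ≤ σ * ((x m - x k) * (x m - x l))) →
        g ({i, j}, {k, l}) ∈ ({t ∈ Q | t.1.card = 2 ∧ t.2.card = 2} : Finset _) := by
      intro i j k l σ hij hj hkl hl hσ hσ₁ hσ₂
      obtain ⟨u, u₁, u₂⟩ := exists_crossing h₁ h₂ hβ₁ hβ₂ hx hx0 hx1 hij hj hkl hl hσ hσ₁ hσ₂
      have card_pair : ∀ {γ : ℝ → E} {i j : ℕ}, Function.Injective γ → i < j →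
          (({i, j} : Finset ℕ).image fun i => γ (x i)).card = 2 := fun {γ _ _} hγ hij => by
        rw [Finset.card_image_of_injective (f := fun i => γ (x i)) _ (hγ.comp hx.injective),
          Finset.card_pair hij.ne]
      have c₁ := card_pair h₁.injective hij
      have c₂ := card_pair h₂.injective hkl
      have hgu : g ({i, j}, {k, l}) = (argmaxOn S₁ u, argmaxOn S₂ u) := Prod.ext u₁.symm u₂.symm
      rw [hgu]
      refine Finset.mem_filter.2 ⟨memQ u (two_le ?_ ?_), ?_, ?_⟩
      · refine two_le_finrank_of_crossing h₁ h₂ hβ₁ hβ₂ ⟨hx0 i, hx1 i⟩ ⟨hx0 j, hx1 j⟩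
          ⟨hx0 k, hx1 k⟩ ⟨hx0 l, hx1 l⟩ (hx hij) (hx hkl) ?_ ?_
        · refine h.vectorSpan_le ne₂ u (sub_mem_vectorSpan ?_ ?_) <;> rw [u₁] <;>
            exact Finset.mem_image.2 ⟨_, by simp, rfl⟩
        · refine h.symm.vectorSpan_le ne₁ u (sub_mem_vectorSpan ?_ ?_) <;> rw [u₂] <;>
            exact Finset.mem_image.2 ⟨_, by simp, rfl⟩
      · rintro rfl
        rw [argmaxOn_zero] at u₁
        have := h₁.card_curvePoints hx n₁
        rw [u₁, c₁] at this
        omega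
      · dsimp only
        rw [u₁, c₁]
      · dsimp only
        rw [u₂, c₂]
    have hsub : (insert (({0, n₁ - 1}, {0, n₂ - 1}) : Finset ℕ × Finset ℕ)
        ((Finset.range (n₁ - 1) ×ˢ Finset.range (n₂ - 1)).image f)).image g ⊆
        {t ∈ Q | t.1.card = 2 ∧ t.2.card = 2} := by
      intro t ht
      obtain ⟨s, hs, rfl⟩ := Finset.mem_image.1 ht
      rcases Finset.mem_insert.1 hs with rfl | hs
      · exact hmem (σ := -1) (by omega) (by omega) (by omega) (by omega) (by norm_num)
          (fun m hm => by linarith [ends n₁ m hm]) (fun m hm => by linarith [ends n₂ m hm])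
      · obtain ⟨⟨i, k⟩, hik, rfl⟩ := Finset.mem_image.1 hs
        rw [Finset.mem_product, Finset.mem_range, Finset.mem_range] at hik
        dsimp only at hik
        exact hmem (σ := 1) (by omega) (by omega) (by omega) (by omega) one_ne_zero
          (fun m _ => by linarith [adj m i]) (fun m _ => by linarith [adj m k])
    have hcard := Finset.card_le_card hsub
    rw [Finset.card_image_of_injective _ hg, Finset.card_insert_of_notMem ?_,
      Finset.card_image_of_injective _ hf, Finset.card_product, Finset.card_range,
      Finset.card_range] at hcard
    · exact hcard
    · intro hmem0
      obtain ⟨⟨i, k⟩, -, hik⟩ := Finset.mem_image.1 hmem0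
      have e := congrArg Prod.fst hik
      have e1 := Finset.ext_iff.1 e 0
      have e2 := Finset.ext_iff.1 e (n₁ - 1)
      simp only [f, Finset.mem_insert, Finset.mem_singleton, true_or, or_true, iff_true] at e1 e2
      omega
  have hdisj₁ : Disjoint ({t ∈ Q | t.1 ∈ vertexFaces 2 S₁} : Finset _)
      {t ∈ Q | t.2 ∈ vertexFaces 2 S₂} := by
    refine Finset.disjoint_filter.2 fun t ht hF₁ hF₂ => ?_
    obtain ⟨-, u, hu, rfl⟩ := Finset.mem_filter.1 ht
    obtain ⟨c₁, e₁, k₁, a₁, l₁, m₁⟩ :=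
      h₁.exists_coeff_of_two_lt_card hx0 hx1 (three_le_card_of_mem_facets hF₁)
    obtain ⟨c₂, e₂, -, a₂, l₂, m₂⟩ :=
      h₂.exists_coeff_of_two_lt_card hx0 hx1 (three_le_card_of_mem_facets hF₂)
    rw [hβ₁] at k₁ a₁
    rw [hβ₂] at a₂
    -- A common normal would satisfy α₁ = e₁α₂/100 and α₂ = e₂α₁/100 with e₁e₂ ≤ 9, which forces u =
    -- 0.
    have hα₁ : α₁ u = 0 := by
      have hee : e₁ * e₂ ≤ 9 := by nlinarith
      refine (mul_eq_zero.1 (?_ : α₁ u * (1 - e₁ * e₂ / 10000) = 0)).resolve_right (by linarith)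
      linear_combination a₁ + e₁ / 100 * a₂
    have hα₂ : α₂ u = 0 := by rw [a₂, hα₁]; ring
    have hu0 : u = 0 := h₁.inj u hα₁ (by rw [k₁, hα₂]; ring) (by rw [hβ₁, hα₂]; ring)
    rw [hu0, argmaxOn_zero] at hu
    omega
  have hdisj₂ : Disjoint (({t ∈ Q | t.1 ∈ vertexFaces 2 S₁} : Finset _) ∪
      {t ∈ Q | t.2 ∈ vertexFaces 2 S₂}) {t ∈ Q | t.1.card = 2 ∧ t.2.card = 2} := by
    rw [Finset.disjoint_union_left]
    constructor
    · refine Finset.disjoint_filter.2 fun t _ hF hc => ?_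
      have := three_le_card_of_mem_facets hF
      omega
    · refine Finset.disjoint_filter.2 fun t _ hF hc => ?_
      have := three_le_card_of_mem_facets hF
      omega
  have hall := Finset.card_le_card (show (({t ∈ Q | t.1 ∈ vertexFaces 2 S₁} : Finset _) ∪
      {t ∈ Q | t.2 ∈ vertexFaces 2 S₂}) ∪ {t ∈ Q | t.1.card = 2 ∧ t.2.card = 2} ⊆ Q from
    Finset.union_subset (Finset.union_subset (Finset.filter_subset _ _) (Finset.filter_subset _ _))
      (Finset.filter_subset _ _))
  rw [Finset.card_union_of_disjoint hdisj₂, Finset.card_union_of_disjoint hdisj₁] at hall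
  have g₁ : 2 * n₁ ≤ (vertexFaces 2 S₁).card + 4 := h₁.le_card_facets hE hx hn₁
  have g₂ : 2 * n₂ ≤ (vertexFaces 2 S₂).card + 4 := h₂.le_card_facets hE hx hn₂
  obtain ⟨m₁, rfl⟩ : ∃ m, n₁ = m + 1 := ⟨n₁ - 1, by omega⟩
  obtain ⟨m₂, rfl⟩ : ∃ m, n₂ = m + 1 := ⟨n₂ - 1, by omega⟩
  simp only [Nat.add_sub_cancel] at q₃
  have expand : (m₁ + 1) * (m₂ + 1) = m₁ * m₂ + m₁ + m₂ + 1 := by ring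
  rw [expand]
  omega

end Crossing

/-! ### The explicit curves and the main theorem -/

section Main

theorem euclidean_dual_apply (u : Module.Dual ℝ (EuclideanSpace ℝ (Fin 3))) (a b c : ℝ) :
    u !₂[a, b, c] = u (EuclideanSpace.single 0 1) * a + u (EuclideanSpace.single 1 1) * b +
      u (EuclideanSpace.single 2 1) * c := by
  have : (!₂[a, b, c] : EuclideanSpace ℝ (Fin 3)) = a • EuclideanSpace.single 0 1 +
      b • EuclideanSpace.single 1 1 + c • EuclideanSpace.single 2 1 := by
    ext i
    fin_cases i <;> simp
  rw [this]
  simp only [map_add, map_smul, smul_eq_mul]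
  ring

theorem exists_euclidean_dual (a b c : ℝ) : ∃ u : Module.Dual ℝ (EuclideanSpace ℝ (Fin 3)),
    u (EuclideanSpace.single 0 1) = a ∧ u (EuclideanSpace.single 1 1) = b ∧
      u (EuclideanSpace.single 2 1) = c :=
  ⟨((a • EuclideanSpace.proj 0 + b • EuclideanSpace.proj 1 + c • EuclideanSpace.proj 2 :
    EuclideanSpace ℝ (Fin 3) →L[ℝ] ℝ) : EuclideanSpace ℝ (Fin 3) →ₗ[ℝ] ℝ),
    by simp, by simp, by simp⟩

theorem euclidean_dual_eq_zero (u : Module.Dual ℝ (EuclideanSpace ℝ (Fin 3)))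
    (h0 : u (EuclideanSpace.single 0 1) = 0) (h1 : u (EuclideanSpace.single 1 1) = 0)
    (h2 : u (EuclideanSpace.single 2 1) = 0) : u = 0 := by
  refine LinearMap.ext fun v => ?_
  have : v = !₂[v 0, v 1, v 2] := by
    ext i
    fin_cases i <;> rfl
  rw [this, euclidean_dual_apply, h0, h1, h2]
  simp

/-- A twisted cubic close to a parabola in the first coordinate plane of the paraboloid. -/
noncomputable def firstCurve (t : ℝ) : EuclideanSpace ℝ (Fin 3) := !₂[t, t ^ 3 / 100, t ^ 2]

/-- A twisted cubic close to a parabola in the second coordinate plane of the paraboloid. -/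
noncomputable def secondCurve (t : ℝ) : EuclideanSpace ℝ (Fin 3) := !₂[t ^ 3 / 100, t, t ^ 2]

theorem isTwistedCubic_firstCurve : IsTwistedCubic firstCurve
    (fun u => u (EuclideanSpace.single 0 1)) (fun u => u (EuclideanSpace.single 2 1))
    (fun u => u (EuclideanSpace.single 1 1) / 100) where
  apply_eq u t := by
    rw [firstCurve, euclidean_dual_apply]
    ring
  surj a k b := by
    obtain ⟨u, h0, h1, h2⟩ := exists_euclidean_dual a (100 * b) k
    exact ⟨u, h0, h2, by rw [h1]; ring⟩
  inj u h0 h2 h1 := euclidean_dual_eq_zero u h0 (by linarith) h2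

theorem isTwistedCubic_secondCurve : IsTwistedCubic secondCurve
    (fun u => u (EuclideanSpace.single 1 1)) (fun u => u (EuclideanSpace.single 2 1))
    (fun u => u (EuclideanSpace.single 0 1) / 100) where
  apply_eq u t := by
    rw [secondCurve, euclidean_dual_apply]
    ring
  surj a k b := by
    obtain ⟨u, h0, h1, h2⟩ := exists_euclidean_dual (100 * b) a k
    exact ⟨u, h1, h2, by rw [h0]; ring⟩
  inj u h1 h2 h0 := euclidean_dual_eq_zero u (by linarith) h1 h2

theorem strictMono_div_add_one : StrictMono fun i : ℕ => (i : ℝ) / (i + 1) :=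
  strictMono_nat_of_lt_succ fun i => by
    rw [div_lt_div_iff₀ (by positivity) (by positivity)]
    push_cast
    linarith

section

variable {E : Type*} [NormedAddCommGroup E] [NormedSpace ℝ E]

theorem faceNumber_zero_convexHull [FiniteDimensional ℝ E] {S : Finset E} (hne : S.Nonempty)
    (hS : ConvexPosition S) :
    faceNumber 0 (convexHull ℝ (S : Set E)) = S.card := by
  rw [faceNumber_convexHull 0 hne, card_vertexFaces_zero hne hS]

theorem convexDim_convexHull (S : Finset E) :
    convexDim (convexHull ℝ (S : Set E)) = vdim S := by
  rw [convexDim, vectorSpan_convexHull, vdim]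

theorem exists_isVertexSum {S₁ S₂ : Finset E} (h₁ : S₁.Nonempty) (h₂ : S₂.Nonempty) :
    ∃ S : Finset E, ConvexPosition S ∧ S.Nonempty ∧ IsVertexSum S S₁ S₂ ∧
      convexHull ℝ (S₁ : Set E) + convexHull ℝ (S₂ : Set E) = convexHull ℝ (S : Set E) := by
  have hpoly : IsPolytope (convexHull ℝ (S₁ : Set E) + convexHull ℝ (S₂ : Set E)) :=
    ⟨S₁ + S₂, S₁.finite_toSet.add S₂.finite_toSet, (convexHull_add _ _).symm⟩
  obtain ⟨S, hS, hS'⟩ := hpoly.exists_convexPosition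
  refine ⟨S, hS, ?_, isVertexSum_of_convexHull_eq hS h₁ h₂ hS'.symm, hS'⟩
  have hne : (convexHull ℝ (S : Set E)).Nonempty := hS' ▸ h₁.to_set.convexHull.add
    h₂.to_set.convexHull
  exact Finset.coe_nonempty.1 (convexHull_nonempty_iff.1 hne)

end

theorem mainTheorem9 :
    -- the two upper bounds
    (∀ P₁ P₂ : Set (EuclideanSpace ℝ (Fin 3)), IsDimPolytope 3 P₁ → IsDimPolytope 3 P₂ →
      (faceNumber 2 (P₁ + P₂) : ℤ) ≤
          faceNumber 0 P₁ * faceNumber 0 P₂ + faceNumber 0 P₁ + faceNumber 0 P₂ - 6 ∧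
        (faceNumber 1 (P₁ + P₂) : ℤ) ≤
          2 * faceNumber 0 P₁ * faceNumber 0 P₂ + faceNumber 0 P₁ + faceNumber 0 P₂ - 8) ∧
    -- tightness: both are attained, for all possible numbers of vertices of the summands
    (∀ n₁ n₂ : ℕ, 4 ≤ n₁ → 4 ≤ n₂ →
      ∃ P₁ P₂ : Set (EuclideanSpace ℝ (Fin 3)), IsDimPolytope 3 P₁ ∧ IsDimPolytope 3 P₂ ∧
        faceNumber 0 P₁ = n₁ ∧ faceNumber 0 P₂ = n₂ ∧
        (faceNumber 2 (P₁ + P₂) : ℤ) = (n₁ : ℤ) * n₂ + n₁ + n₂ - 6 ∧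
        (faceNumber 1 (P₁ + P₂) : ℤ) = 2 * (n₁ : ℤ) * n₂ + n₁ + n₂ - 8) := by
  have hE : Module.finrank ℝ (EuclideanSpace ℝ (Fin 3)) = 3 := finrank_euclideanSpace_fin
  constructor
  · rintro P₁ P₂ ⟨hP₁, hne₁, hd₁⟩ ⟨hP₂, hne₂, hd₂⟩
    obtain ⟨S₁, hS₁, rfl⟩ := hP₁.exists_convexPosition
    obtain ⟨S₂, hS₂, rfl⟩ := hP₂.exists_convexPosition
    have ne₁ : S₁.Nonempty := Finset.coe_nonempty.1 (convexHull_nonempty_iff.1 hne₁)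
    have ne₂ : S₂.Nonempty := Finset.coe_nonempty.1 (convexHull_nonempty_iff.1 hne₂)
    obtain ⟨S, hS, ne, h, heq⟩ := exists_isVertexSum ne₁ ne₂
    rw [convexDim_convexHull] at hd₁ hd₂
    have hd := h.vdim_eq hE ne₂ hd₁
    have b₂ := h.card_facets_add_six_le hE hS ne hS₁ hS₂ hd hd₁ hd₂
    have b₁ := h.card_edges_add_eight_le hE hS ne hS₁ hS₂ hd hd₁ hd₂
    rw [heq, faceNumber_convexHull 2 ne, faceNumber_convexHull 1 ne,
      faceNumber_zero_convexHull ne₁ hS₁, faceNumber_zero_convexHull ne₂ hS₂]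
    zify at b₁ b₂
    constructor <;> linarith
  · intro n₁ n₂ hn₁ hn₂
    -- Any strictly increasing sequence in [0, 1] would serve; this one works for all n₁, n₂ at
    -- once.
    let x : ℕ → ℝ := fun i => (i : ℝ) / (i + 1)
    have hx : StrictMono x := strictMono_div_add_one
    have hx0 : ∀ i, 0 ≤ x i := fun i => by positivity
    have hx1 : ∀ i, x i ≤ 1 := fun i => div_le_one_of_le₀ (by linarith) (by positivity)
    have h₁ := isTwistedCubic_firstCurve
    have h₂ := isTwistedCubic_secondCurve
    have hS₁ := h₁.convexPosition (x := x) n₁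
    have hS₂ := h₂.convexPosition (x := x) n₂
    have c₁ := h₁.card_curvePoints hx n₁
    have c₂ := h₂.card_curvePoints hx n₂
    have hd₁ := (h₁.vdim_curvePoints hx hn₁).trans hE
    have hd₂ := (h₂.vdim_curvePoints hx hn₂).trans hE
    have ne₁ : (curvePoints firstCurve x n₁).Nonempty := Finset.card_pos.1 (by omega)
    have ne₂ : (curvePoints secondCurve x n₂).Nonempty := Finset.card_pos.1 (by omega)
    obtain ⟨S, hS, ne, h, heq⟩ := exists_isVertexSum ne₁ ne₂
    have hd := h.vdim_eq hE ne₂ hd₁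
    have low := le_card_facets_curve_sum hE h₁ h₂ (fun _ => rfl) (fun _ => rfl) hx hx0 hx1 hn₁ hn₂
      h ne
    have b₂ := h.card_facets_add_six_le hE hS ne hS₁ hS₂ hd hd₁ hd₂
    have b₁ := h.card_edges_add_eight_le hE hS ne hS₁ hS₂ hd hd₁ hd₂
    have b₁' := h.le_card_edges_add_eight hE hS ne hS₁ hS₂ hd hd₁ hd₂ (by rw [c₁, c₂]; exact low)
    refine ⟨convexHull ℝ (curvePoints firstCurve x n₁), convexHull ℝ (curvePoints secondCurve x n₂),
      ⟨⟨_, Finset.finite_toSet _, rfl⟩, ne₁.to_set.convexHull, ?_⟩,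
      ⟨⟨_, Finset.finite_toSet _, rfl⟩, ne₂.to_set.convexHull, ?_⟩, ?_, ?_, ?_⟩
    · rw [convexDim_convexHull, hd₁]
    · rw [convexDim_convexHull, hd₂]
    · rw [faceNumber_zero_convexHull ne₁ hS₁, c₁]
    · rw [faceNumber_zero_convexHull ne₂ hS₂, c₂]
    · rw [c₁, c₂] at b₁ b₁' b₂
      rw [heq, faceNumber_convexHull 2 ne, faceNumber_convexHull 1 ne]
      zify at low b₁ b₁' b₂
      constructor <;> linarith

end Main
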